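/- Consider the defocusing cubic nonlinear Schrödinger equation on the half-line, $$ i q_t + q_{xx} - 2|q|^2 q = 0,\qquad x>0,\ t>0, \qquad q(x,0)=q_0(x)\ (x\ge 0),\qquad q(0,t)=Q(t)\ (t\ge 0), $$ where $Q\in C^2([0,\infty))$ and $Q(0)=q_0(0)$. Let $q\in C^1([0,\infty);L^2(0,\infty))\cap C^0([0,\infty);H^2(0,\infty))$ be the global solution of this problem. Assume that $x\,q_0\in L^2(0,\infty)$ and that, as $t\to\infty$, $$ q(0,t)=O(t^{-\alpha}),\qquad q_t(0,t)=O(t^{-\beta}),\qquad\text{for some } \alpha>\tfrac32 \text{ and } \beta>\tfrac52 . $$ Then there exists a constant $c>0$, independent of $t$, such that $$ \|q(\cdot,t)\|_{L^4(0,\infty)}^4=\int_0^\infty |q(x,t)|^4\,dx\le \frac{c}{t}\qquad\text{for all } t\ge 1 . $$ -/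

import Mathlib

open MeasureTheory Set Filter Topology Asymptotics
open scoped ContDiff

namespace HalfLineNLS

/-- Lebesgue measure on the half-line `(0, ∞)`. -/
noncomputable abbrev halfLine : Measure ℝ := volume.restrict (Ioi 0)

/-- The Hilbert space `L²(0, ∞)` of complex-valued functions. -/
abbrev L2 : Type := Lp ℂ 2 halfLine

/-- `g ∈ L²(0, ∞)` is the weak derivative of `f ∈ L²(0, ∞)`: integration by parts holds against
every smooth function with compact support in the open half-line `(0, ∞)`. -/
def HasWeakDeriv (f g : L2) : Prop :=
  ∀ φ : ℝ → ℝ, ContDiff ℝ ∞ φ → HasCompactSupport φ → tsupport φ ⊆ Ioi 0 →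
    ∫ x in Ioi 0, ((deriv φ x : ℝ) : ℂ) * f x = - ∫ x in Ioi 0, ((φ x : ℝ) : ℂ) * g x

/-- `q x t` (position `x`, time `t`) is a global solution, of class
`C¹([0, ∞); L²(0, ∞)) ∩ C⁰([0, ∞); H²(0, ∞))`, of the defocusing cubic Schrödinger equation
`i q_t + q_xx - 2 |q|² q = 0` for `x > 0`, `t > 0`, with `q(x, 0) = q₀(x)` and `q(0, t) = Q(t)`.

For each time `q(·, t)` is the continuous representative on `[0, ∞)` of its `L²` class, so that
its boundary value at `x = 0` is the trace. Only values with `x ≥ 0` and `t ≥ 0` matter. -/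
structure IsSolution (q₀ Q : ℝ → ℂ) (q : ℝ → ℝ → ℂ) : Prop where
  /-- `q(·, t)` is continuous up to the boundary. -/
  continuousOn_space : ∀ t, 0 ≤ t → ContinuousOn (fun x => q x t) (Ici 0)
  /-- Regularity and the equation. Here `u t`, `ux t`, `uxx t` are the classes in `L²(0, ∞)` of
  `q(·, t)`, `q_x(·, t)`, `q_xx(·, t)`; continuity of the three curves is continuity of
  `t ↦ q(·, t)` for the `H²` norm. The time derivative is taken in `L²(0, ∞)`
  (one-sided at `t = 0`). -/
  regularity_and_equation : ∃ u ux uxx : ℝ → L2,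
    (∀ t, 0 ≤ t → (fun x => q x t) =ᵐ[halfLine] u t) ∧
    ContDiffOn ℝ 1 u (Ici 0) ∧
    (∀ t, 0 ≤ t → HasWeakDeriv (u t) (ux t)) ∧
    (∀ t, 0 ≤ t → HasWeakDeriv (ux t) (uxx t)) ∧
    ContinuousOn u (Ici 0) ∧ ContinuousOn ux (Ici 0) ∧ ContinuousOn uxx (Ici 0) ∧
    (∀ t, 0 < t → ∀ᵐ x ∂halfLine,
      Complex.I * (derivWithin u (Ici 0) t : L2) x + uxx t x
        - 2 * ((‖q x t‖ ^ 2 : ℝ) : ℂ) * q x t = 0)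
  /-- Initial condition. -/
  initial : ∀ x, 0 ≤ x → q x 0 = q₀ x
  /-- Dirichlet boundary condition. -/
  boundary : ∀ t, 0 ≤ t → q 0 t = Q t

end HalfLineNLS

/-! The proof is a pseudoconformal energy argument in which the unknown Neumann trace is absorbed by
the momentum law. Write P = q_x(0,t), N = ∫|q|⁴ and E = ‖q_x‖² + N. The quantity t⁻¹‖(x + 2it∂_x)q‖²
+ 4tN equals ‖xq‖²/t − 4 Im⟨q, x q_x⟩ + 4tE. In its time derivative the quartic terms cancel and the
bulk is the nonpositive −t⁻²‖(x + 2it∂_x)q‖². What remains are the boundary terms −4 Re(P̄Q) − 8t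
Re(Q̄'P), which are linear in P. The derivative of −Im⟨q, q_x⟩ contains −|P|², so subtracting the
momentum allows completion of the square (`boundary_term_le`); with |Q| ≤ C/t and |Q'| ≤ C/t² the
remainder is O(t⁻²), hence integrable. Adding E and ‖q‖² compensates the indefinite sign of the
momentum. The resulting functional `lyapunov` stays bounded (`exists_deriv_lyapunov_le`,
`lyapunov_le`) and dominates 4tN (`lyapunov_ge`).

Two points need care. The weight x is unbounded, so it is replaced by (1 − e^{−εx})/ε; the second
moment at time 1 is bounded uniformly in ε (`exists_norm_truncation_le`), and the error in the
monotonicity formula disappears as ε → 0 (`tendsto_integral_truncationError`). Moreover q_x need not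
be differentiable in time with values in L². Each functional is therefore differentiated through its
exact increment, with integration by parts used where needed to leave only increments of q and of
its boundary value (`hasDerivAt_of_inner_increment`). -/

namespace HalfLineNLS

/-! ### Product rule for integrals of locally integrable functions -/

open ComplexConjugate

/-- Both primitives are absolutely continuous, so their product is the integral of its a.e.
derivative; the term at 0 vanishes. -/
theorem integral_mul_add_mul_integral_real {f g : ℝ → ℝ} {x : ℝ}
    (hf : IntervalIntegrable f volume 0 x) (hg : IntervalIntegrable g volume 0 x) :
    ∫ y in 0..x, (f y * (∫ z in 0..y, g z) + (∫ z in 0..y, f z) * g y)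
      = (∫ y in 0..x, f y) * ∫ y in 0..x, g y := by
  have hF := hf.absolutelyContinuousOnInterval_intervalIntegral (c := 0) (by simp)
  have hG := hg.absolutelyContinuousOnInterval_intervalIntegral (c := 0) (by simp)
  have h := hF.integral_deriv_mul_eq_sub hG
  simp only [intervalIntegral.integral_same, mul_zero, sub_zero] at h
  rw [← h]
  apply intervalIntegral.integral_congr_ae
  filter_upwards [hf.ae_hasDerivAt_integral, hg.ae_hasDerivAt_integral] with y h1 h2 hy
  rw [(h1 (uIoc_subset_uIcc hy) 0 (by simp)).deriv, (h2 (uIoc_subset_uIcc hy) 0 (by simp)).deriv]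

theorem intervalIntegrable_mul_integral {f g : ℝ → ℂ} {x : ℝ}
    (hf : IntervalIntegrable f volume 0 x) (hg : IntervalIntegrable g volume 0 x) :
    IntervalIntegrable (fun y => f y * ∫ z in 0..y, g z) volume 0 x :=
  hf.mul_continuousOn (intervalIntegral.continuousOn_primitive_interval' hg (by simp))

theorem integral_mul_add_mul_integral {f g : ℝ → ℂ} {x : ℝ}
    (hf : IntervalIntegrable f volume 0 x) (hg : IntervalIntegrable g volume 0 x) :
    ∫ y in 0..x, (f y * (∫ z in 0..y, g z) + (∫ z in 0..y, f z) * g y)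
      = (∫ y in 0..x, f y) * ∫ y in 0..x, g y := by
  have re_int : ∀ {h : ℝ → ℂ}, IntervalIntegrable h volume 0 x →
      IntervalIntegrable (fun y => (h y).re) volume 0 x := fun hh =>
    ⟨hh.1.re, hh.2.re⟩
  have im_int : ∀ {h : ℝ → ℂ}, IntervalIntegrable h volume 0 x →
      IntervalIntegrable (fun y => (h y).im) volume 0 x := fun hh =>
    ⟨hh.1.im, hh.2.im⟩
  have re_eq : ∀ {h : ℝ → ℂ} {y : ℝ}, IntervalIntegrable h volume 0 y →
      (∫ z in 0..y, h z).re = ∫ z in 0..y, (h z).re := fun hh =>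
    (Complex.reCLM.intervalIntegral_comp_comm hh).symm
  have im_eq : ∀ {h : ℝ → ℂ} {y : ℝ}, IntervalIntegrable h volume 0 y →
      (∫ z in 0..y, h z).im = ∫ z in 0..y, (h z).im := fun hh =>
    (Complex.imCLM.intervalIntegral_comp_comm hh).symm
  have sub : ∀ {h : ℝ → ℂ} {y : ℝ}, IntervalIntegrable h volume 0 x → y ∈ uIcc 0 x →
      IntervalIntegrable h volume 0 y := fun hh hy =>
    hh.mono_set (uIcc_subset_uIcc_left hy)
  have hfg := intervalIntegrable_mul_integral hf hg
  have hgf : IntervalIntegrable (fun y => (∫ z in 0..y, f z) * g y) volume 0 x := by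
    simpa only [mul_comm] using intervalIntegrable_mul_integral hg hf
  have I : ∀ {a b : ℝ → ℝ}, IntervalIntegrable a volume 0 x → IntervalIntegrable b volume 0 x →
      IntervalIntegrable (fun y => a y * (∫ z in 0..y, b z) + (∫ z in 0..y, a z) * b y)
        volume 0 x := fun ha hb =>
    (ha.mul_continuousOn (intervalIntegral.continuousOn_primitive_interval' hb (by simp))).add
      (hb.continuousOn_mul (intervalIntegral.continuousOn_primitive_interval' ha (by simp)))
  apply Complex.ext
  · rw [re_eq (hfg.add hgf), Complex.mul_re, re_eq hf, re_eq hg, im_eq hf, im_eq hg,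
      ← integral_mul_add_mul_integral_real (re_int hf) (re_int hg),
      ← integral_mul_add_mul_integral_real (im_int hf) (im_int hg),
      ← intervalIntegral.integral_sub (I (re_int hf) (re_int hg)) (I (im_int hf) (im_int hg))]
    apply intervalIntegral.integral_congr
    intro y hy
    simp only [Complex.add_re, Complex.mul_re, re_eq (sub hf hy), re_eq (sub hg hy),
      im_eq (sub hf hy), im_eq (sub hg hy)]
    ring
  · rw [im_eq (hfg.add hgf), Complex.mul_im, re_eq hf, re_eq hg, im_eq hf, im_eq hg,
      ← integral_mul_add_mul_integral_real (re_int hf) (im_int hg),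
      ← integral_mul_add_mul_integral_real (im_int hf) (re_int hg),
      ← intervalIntegral.integral_add (I (re_int hf) (im_int hg)) (I (im_int hf) (re_int hg))]
    apply intervalIntegral.integral_congr
    intro y hy
    simp only [Complex.add_im, Complex.mul_im, re_eq (sub hf hy), re_eq (sub hg hy),
      im_eq (sub hf hy), im_eq (sub hg hy)]
    ring

/-! ### Indefinite integrals on the half-line and integration by parts -/

/-- `F` is an indefinite integral of the locally integrable function `f` on `[0, ∞)`. -/
structure IsPrimitive (F f : ℝ → ℂ) : Prop where
  intervalIntegrable : ∀ x, 0 ≤ x → IntervalIntegrable f volume 0 x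
  eq_add_integral : ∀ x, 0 ≤ x → F x = F 0 + ∫ y in 0..x, f y

namespace IsPrimitive

variable {F f G g : ℝ → ℂ}

theorem continuousOn (h : IsPrimitive F f) : ContinuousOn F (Ici 0) := by
  intro x hx
  have hx0 : (0 : ℝ) ≤ x := hx
  have h1 : ContinuousOn (fun x => F 0 + ∫ y in 0..x, f y) (uIcc 0 (x + 1)) :=
    continuousOn_const.add (intervalIntegral.continuousOn_primitive_interval'
      (h.intervalIntegrable (x + 1) (by linarith)) (by simp))
  have h2 : ContinuousOn F (Icc 0 (x + 1)) := by
    rw [uIcc_of_le (by linarith)] at h1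
    exact h1.congr fun y hy => h.eq_add_integral y hy.1
  refine (h2 x ⟨hx0, by linarith⟩).mono_of_mem_nhdsWithin ?_
  rw [← Ici_inter_Iic]
  exact inter_mem_nhdsWithin _ (Iic_mem_nhds (by linarith))

theorem congr_deriv (h : IsPrimitive F f) (hfg : f =ᵐ[halfLine] g) : IsPrimitive F g := by
  have key : ∀ x, 0 ≤ x → f =ᵐ[volume.restrict (uIoc 0 x)] g := fun x hx => by
    rw [uIoc_of_le hx]
    exact ae_restrict_of_ae_restrict_of_subset Ioc_subset_Ioi_self hfg
  refine ⟨fun x hx => (h.intervalIntegrable x hx).congr_ae (key x hx), fun x hx => ?_⟩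
  rw [h.eq_add_integral x hx, intervalIntegral.integral_congr_ae_restrict (key x hx)]

theorem sub (h : IsPrimitive F f) (h' : IsPrimitive G g) :
    IsPrimitive (fun x => F x - G x) (fun x => f x - g x) where
  intervalIntegrable x hx := (h.intervalIntegrable x hx).sub (h'.intervalIntegrable x hx)
  eq_add_integral x hx := by
    rw [intervalIntegral.integral_sub (h.intervalIntegrable x hx) (h'.intervalIntegrable x hx),
      h.eq_add_integral x hx, h'.eq_add_integral x hx]
    ring

theorem add (h : IsPrimitive F f) (h' : IsPrimitive G g) :
    IsPrimitive (fun x => F x + G x) (fun x => f x + g x) where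
  intervalIntegrable x hx := (h.intervalIntegrable x hx).add (h'.intervalIntegrable x hx)
  eq_add_integral x hx := by
    rw [intervalIntegral.integral_add (h.intervalIntegrable x hx) (h'.intervalIntegrable x hx),
      h.eq_add_integral x hx, h'.eq_add_integral x hx]
    ring

theorem conjugate (h : IsPrimitive F f) :
    IsPrimitive (fun x => conj (F x)) (fun x => conj (f x)) where
  intervalIntegrable x hx :=
    ⟨Complex.conjCLE.toContinuousLinearMap.integrable_comp (h.intervalIntegrable x hx).1,
      Complex.conjCLE.toContinuousLinearMap.integrable_comp (h.intervalIntegrable x hx).2⟩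
  eq_add_integral x hx := by
    have := Complex.conjCLE.toContinuousLinearMap.intervalIntegral_comp_comm
      (h.intervalIntegrable x hx)
    simp only [ContinuousLinearEquiv.coe_coe, Complex.conjCLE_apply] at this
    rw [this, h.eq_add_integral x hx, map_add]

theorem mul (h : IsPrimitive F f) (h' : IsPrimitive G g) :
    IsPrimitive (fun x => F x * G x) (fun x => f x * G x + F x * g x) where
  intervalIntegrable x hx := by
    have hs : uIcc 0 x ⊆ Ici 0 := by rw [uIcc_of_le hx]; exact Icc_subset_Ici_self
    exact ((h.intervalIntegrable x hx).mul_continuousOn (h'.continuousOn.mono hs)).add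
      ((h'.intervalIntegrable x hx).continuousOn_mul (h.continuousOn.mono hs))
  eq_add_integral x hx := by
    have hf := h.intervalIntegrable x hx
    have hg := h'.intervalIntegrable x hx
    have key := integral_mul_add_mul_integral hf hg
    have hfg := intervalIntegrable_mul_integral hf hg
    have hgf : IntervalIntegrable (fun y => (∫ z in 0..y, f z) * g y) volume 0 x := by
      simpa only [mul_comm] using intervalIntegrable_mul_integral hg hf
    have e : ∫ y in 0..x, (f y * G y + F y * g y)
        = ∫ y in 0..x, ((f y * G 0 + F 0 * g y)
          + (f y * (∫ z in 0..y, g z) + (∫ z in 0..y, f z) * g y)) := by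
      apply intervalIntegral.integral_congr
      intro y hy
      rw [uIcc_of_le hx] at hy
      simp only [h.eq_add_integral y hy.1, h'.eq_add_integral y hy.1]
      ring
    rw [e, intervalIntegral.integral_add ((hf.mul_const _).add (hg.const_mul _)) (hfg.add hgf),
      key, intervalIntegral.integral_add (hf.mul_const _) (hg.const_mul _),
      intervalIntegral.integral_mul_const, intervalIntegral.integral_const_mul,
      h.eq_add_integral x hx, h'.eq_add_integral x hx]
    ring

theorem of_hasDerivAt {w w' : ℝ → ℝ} (h : ∀ x, HasDerivAt w (w' x) x) (hc : Continuous w') :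
    IsPrimitive (fun x => (w x : ℂ)) (fun x => (w' x : ℂ)) where
  intervalIntegrable x _ := (Complex.continuous_ofReal.comp hc).intervalIntegrable _ _
  eq_add_integral x _ := by
    rw [intervalIntegral.integral_eq_sub_of_hasDerivAt (fun y _ => (h y).ofReal_comp)
      ((Complex.continuous_ofReal.comp hc).intervalIntegrable _ _)]
    ring

/-- An integrable indefinite integral of an integrable function vanishes at infinity. -/
theorem integral_Ioi (h : IsPrimitive F f) (hF : IntegrableOn F (Ioi 0))
    (hf : IntegrableOn f (Ioi 0)) : ∫ x in Ioi 0, f x = - F 0 := by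
  have h1 : Tendsto F atTop (𝓝 (F 0 + ∫ x in Ioi 0, f x)) := by
    refine ((intervalIntegral_tendsto_integral_Ioi 0 hf tendsto_id).const_add (F 0)).congr' ?_
    filter_upwards [eventually_ge_atTop 0] with x hx
    exact (h.eq_add_integral x hx).symm
  -- Integrability of `f` gives `F` a limit at infinity; since neighbourhoods of infinity have
  -- infinite measure, integrability of `F` forces that limit to be 0.
  have h2 : IntegrableAtFilter F atTop volume := ⟨Ioi 0, Ioi_mem_atTop 0, hF⟩
  have := h2.eq_zero_of_tendsto (fun s hs => by
    obtain ⟨b, hb⟩ := mem_atTop_sets.1 hs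
    rw [← top_le_iff, ← Real.volume_Ici (a := b)]
    exact measure_mono hb) h1
  linear_combination this

theorem memLp_continuousOn_mul {w : ℝ → ℝ} (hw : Continuous w) {C : ℝ}
    (hC : ∀ x ∈ Ioi (0 : ℝ), |w x| ≤ C) (hF : MemLp F 2 halfLine) :
    MemLp (fun x => (w x : ℂ) * F x) 2 halfLine := by
  refine hF.of_le_mul (c := C)
    ((Complex.continuous_ofReal.comp hw).aestronglyMeasurable.mul hF.1) ?_
  filter_upwards [ae_restrict_mem measurableSet_Ioi] with x hx
  rw [norm_mul, Complex.norm_real, Real.norm_eq_abs]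
  exact mul_le_mul_of_nonneg_right (hC x hx) (norm_nonneg _)

theorem _root_.MeasureTheory.MemLp.integrable_conj_mul {μ : Measure ℝ} (hF : MemLp F 2 μ)
    (hG : MemLp G 2 μ) : Integrable (fun x => conj (F x) * G x) μ := by
  have := hF.star.integrable_mul hG
  exact this

/-- Weighted integration by parts on the half-line. -/
theorem integral_weight (hF : IsPrimitive F f) (hG : IsPrimitive G g)
    (mF : MemLp F 2 halfLine) (mf : MemLp f 2 halfLine)
    (mG : MemLp G 2 halfLine) (mg : MemLp g 2 halfLine)
    {w w' : ℝ → ℝ} (hw : ∀ x, HasDerivAt w (w' x) x) (hc : Continuous w') {C C' : ℝ}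
    (hC : ∀ x ∈ Ioi (0 : ℝ), |w x| ≤ C) (hC' : ∀ x ∈ Ioi (0 : ℝ), |w' x| ≤ C') :
    (∫ x in Ioi 0, conj (F x) * (w' x * G x)) + (∫ x in Ioi 0, conj (f x) * (w x * G x))
      + (∫ x in Ioi 0, conj (F x) * (w x * g x)) = - (conj (F 0) * (w 0 * G 0)) := by
  have hwc : Continuous w := continuous_iff_continuousAt.2 fun x => (hw x).continuousAt
  have m1 := memLp_continuousOn_mul hwc hC mG
  have m2 := memLp_continuousOn_mul hwc hC mg
  have m3 := memLp_continuousOn_mul hc hC' mG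
  have i1 := mF.integrable_conj_mul m3
  have i2 := mf.integrable_conj_mul m1
  have i3 := mF.integrable_conj_mul m2
  have hp := hF.conjugate.mul ((of_hasDerivAt hw hc).mul hG)
  have h := hp.integral_Ioi (mF.integrable_conj_mul m1) (((i1.add i2).add i3).congr
    (.of_forall fun x => by simp only [Pi.add_apply]; ring))
  have e1 := integral_add i1 i2
  have e2 := integral_add (i1.add i2) i3
  simp only [Pi.add_apply] at e1 e2
  rw [← h, ← e1, ← e2]
  congr 1
  ext x
  ring

end IsPrimitive

/-! ### From weak derivatives to indefinite integrals -/

/-- A test function of integral zero on the half-line has a test function as primitive. -/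
theorem exists_test_primitive {η : ℝ → ℝ} (hη : ContDiff ℝ ∞ η) (hc : HasCompactSupport η)
    (hs : tsupport η ⊆ Ioi 0) (h0 : ∫ x, η x = 0) :
    ∃ φ : ℝ → ℝ, ContDiff ℝ ∞ φ ∧ HasCompactSupport φ ∧ tsupport φ ⊆ Ioi 0 ∧ deriv φ = η := by
  obtain ⟨a, b, ha, hab⟩ : ∃ a b : ℝ, 0 < a ∧ tsupport η ⊆ Icc a b := by
    rcases (tsupport η).eq_empty_or_nonempty with he | hne
    · exact ⟨1, 1, one_pos, by simp [he]⟩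
    · obtain ⟨a, ha, hmin⟩ := hc.isCompact.exists_isLeast hne
      obtain ⟨b, hb, hmax⟩ := hc.isCompact.exists_isGreatest hne
      exact ⟨a, b, hs ha, fun x hx => ⟨hmin hx, hmax hx⟩⟩
  have hz : ∀ x, x ∉ Icc a b → η x = 0 := fun x hx =>
    image_eq_zero_of_notMem_tsupport fun h => hx (hab h)
  have hi : Integrable η := hη.continuous.integrable_of_hasCompactSupport hc
  have hd : ∀ x, HasDerivAt (fun x => ∫ y in 0..x, η y) (η x) x := fun x =>
    hη.continuous.integral_hasStrictDerivAt 0 x |>.hasDerivAt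
  have hderiv : deriv (fun x => ∫ y in 0..x, η y) = η := funext fun x => (hd x).deriv
  -- To the left of `a` the integrand vanishes; to the right of `b` the primitive is the full
  -- integral of `η`, which is zero.
  have hsupp : Function.support (fun x => ∫ y in 0..x, η y) ⊆ Icc a b := by
    intro x hx
    by_contra hx'
    apply hx
    rcases lt_or_ge x a with h | h
    · refine (intervalIntegral.integral_congr (g := fun _ => 0) fun y hy => hz y fun h' => ?_).trans
        (by simp)
      rcases le_total 0 x with h3 | h3
      · rw [uIcc_of_le h3] at hy; linarith [hy.2, h'.1]
      · rw [uIcc_of_ge h3] at hy; linarith [hy.2, h'.1]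
    · have hbx : b < x := by
        by_contra h'
        exact hx' ⟨h, not_lt.1 h'⟩
      have hx0 : 0 ≤ x := ha.le.trans h
      show ∫ y in 0..x, η y = 0
      rw [intervalIntegral.integral_of_le hx0]
      refine Eq.trans ?_ h0
      refine setIntegral_eq_integral_of_forall_compl_eq_zero fun y hy => hz y fun h' => hy ?_
      exact ⟨ha.trans_le h'.1, h'.2.trans hbx.le⟩
  have htsupp : tsupport (fun x => ∫ y in 0..x, η y) ⊆ Icc a b :=
    closure_minimal hsupp isClosed_Icc
  refine ⟨fun x => ∫ y in 0..x, η y, ?_, ?_, ?_, hderiv⟩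
  · rw [contDiff_infty_iff_deriv, hderiv]
    exact ⟨fun x => (hd x).differentiableAt, hη⟩
  · exact isCompact_Icc.of_isClosed_subset (isClosed_tsupport _) htsupp
  · exact htsupp.trans fun x hx => ha.trans_le hx.1

/-- Du Bois-Reymond's lemma on the half-line. -/
theorem ae_eq_const_of_integral_deriv_eq_zero {h : ℝ → ℂ} (hh : LocallyIntegrable h)
    (H : ∀ φ : ℝ → ℝ, ContDiff ℝ ∞ φ → HasCompactSupport φ → tsupport φ ⊆ Ioi 0 →
      ∫ x, deriv φ x • h x = 0) : ∃ c : ℂ, ∀ᵐ x ∂halfLine, h x = c := by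
  -- Centre 2 and outer radius 1 place the support in [1, 3], away from the boundary. The constant
  -- sought is the average of `h` against this bump.
  let ψ₀ : ContDiffBump (2 : ℝ) := ⟨1 / 2, 1, by norm_num, by norm_num⟩
  set ψ : ℝ → ℝ := ψ₀.normed volume with hψ
  have ψs : ContDiff ℝ ∞ ψ := ψ₀.contDiff_normed
  have ψc : HasCompactSupport ψ := ψ₀.hasCompactSupport_normed
  have ψt : tsupport ψ ⊆ Ioi 0 := by
    rw [hψ, ψ₀.tsupport_normed_eq]
    intro x hx
    rw [Metric.mem_closedBall, Real.dist_eq, abs_le] at hx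
    have : -1 ≤ x - 2 := hx.1
    show 0 < x
    linarith
  have ψi : ∫ x, ψ x = 1 := ψ₀.integral_normed
  set c := ∫ x, ψ x • h x with hc
  refine ⟨c, ?_⟩
  have key := isOpen_Ioi.ae_eq_zero_of_integral_contDiff_smul_eq_zero (μ := volume)
    (U := Ioi (0 : ℝ)) (f := fun x => h x - c)
    ((hh.sub (locallyIntegrable_const c)).locallyIntegrableOn _) ?_
  · rw [ae_restrict_iff' measurableSet_Ioi]
    filter_upwards [key] with x hx h'
    exact sub_eq_zero.1 (hx h')
  · intro η ηs ηc ηt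
    set m := ∫ x, η x with hm
    have hiη : Integrable η := ηs.continuous.integrable_of_hasCompactSupport ηc
    have hiψ : Integrable ψ := ψs.continuous.integrable_of_hasCompactSupport ψc
    have c1 : HasCompactSupport (fun x => m * ψ x) := ψc.mul_left
    have ts : tsupport (fun x => m * ψ x) ⊆ tsupport ψ :=
      closure_mono (Function.support_mul_subset_right _ _)
    -- Subtracting `m * ψ` makes the integral zero, so the difference is the derivative of an
    -- admissible test function.
    obtain ⟨φ, φs, φc, φt, hφ⟩ := exists_test_primitive (η := fun x => η x - m * ψ x)
      (ηs.sub (contDiff_const.mul ψs)) (ηc.sub c1)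
      ((tsupport_sub η (fun x => m * ψ x)).trans (union_subset ηt (ts.trans ψt)))
      (by rw [integral_sub hiη (hiψ.const_mul m), integral_const_mul, ψi]; simp [hm])
    have h1 := H φ φs φc φt
    have i1 := hh.integrable_smul_left_of_hasCompactSupport ηs.continuous ηc
    have i2 := hh.integrable_smul_left_of_hasCompactSupport ψs.continuous ψc
    have e1 : ∫ x, deriv φ x • h x = (∫ x, η x • h x) - m • c := by
      have e := integral_sub i1 (i2.smul m)
      simp only [Pi.smul_apply] at e
      rw [hc, ← integral_smul, ← e, hφ]
      congr 1
      ext x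
      simp only [sub_smul, mul_smul]
    rw [e1, sub_eq_zero] at h1
    simp only [smul_sub]
    rw [integral_sub i1 (hiη.smul_const c), h1, integral_smul_const, sub_self]

theorem L2.intervalIntegrable (g : L2) {x : ℝ} (hx : 0 ≤ x) :
    IntervalIntegrable g volume 0 x := by
  rw [intervalIntegrable_iff_integrableOn_Ioc_of_le hx]
  have h : MemLp g 2 (volume.restrict (Ioc 0 x)) :=
    (Lp.memLp g).mono_measure (Measure.restrict_mono Ioc_subset_Ioi_self le_rfl)
  have : IsFiniteMeasure (volume.restrict (Ioc 0 x)) := ⟨by simp⟩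
  exact h.integrable (by norm_num)

theorem L2.locallyIntegrable_indicator (g : L2) :
    LocallyIntegrable ((Ioi (0 : ℝ)).indicator g) := by
  have h : MemLp ((Ioi (0 : ℝ)).indicator g) 2 volume :=
    (memLp_indicator_iff_restrict measurableSet_Ioi).2 (Lp.memLp g)
  exact h.locallyIntegrable (by norm_num)

/-- A function with a weak derivative in `L²` is an indefinite integral of it. -/
theorem HasWeakDeriv.exists_isPrimitive {f g : L2} (h : HasWeakDeriv f g) :
    ∃ F : ℝ → ℂ, f =ᵐ[halfLine] F ∧ IsPrimitive F g := by
  set G : ℝ → ℂ := fun x => ∫ y in 0..x, (Ioi (0 : ℝ)).indicator g y with hG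
  have li := L2.locallyIntegrable_indicator g
  have ii : ∀ a b, IntervalIntegrable ((Ioi (0 : ℝ)).indicator g) volume a b := fun a b =>
    (li.integrableOn_isCompact isCompact_uIcc).intervalIntegrable
  have hGc : Continuous G :=
    intervalIntegral.continuous_primitive ii 0
  have hGp : IsPrimitive G ((Ioi (0 : ℝ)).indicator g) :=
    ⟨fun x _ => ii 0 x, fun x _ => by simp [hG]⟩
  have ind : (Ioi (0 : ℝ)).indicator g =ᵐ[halfLine] g := indicator_ae_eq_restrict measurableSet_Ioi
  have lf := L2.locallyIntegrable_indicator f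
  -- The difference between `f` and the primitive of `g` has zero weak derivative.
  obtain ⟨c, hc⟩ : ∃ c : ℂ, ∀ᵐ x ∂halfLine, (Ioi (0 : ℝ)).indicator f x - G x = c := by
    refine ae_eq_const_of_integral_deriv_eq_zero (lf.sub hGc.locallyIntegrable) ?_
    intro φ φs φc φt
    have φ'c : Continuous (deriv φ) := φs.continuous_deriv (by simp)
    have φ'cs : HasCompactSupport (deriv φ) := φc.deriv
    have hφ0 : φ 0 = 0 := image_eq_zero_of_notMem_tsupport fun h' => lt_irrefl (0 : ℝ) (φt h')
    have off : ∀ x, x ∉ Ioi (0 : ℝ) → deriv φ x = 0 := fun x hx =>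
      image_eq_zero_of_notMem_tsupport fun h' => hx (φt (tsupport_deriv_subset h'))
    have i1 := lf.integrable_smul_left_of_hasCompactSupport φ'c φ'cs
    have i2 := hGc.locallyIntegrable (μ := volume).integrable_smul_left_of_hasCompactSupport φ'c φ'cs
    have i3 := hGc.locallyIntegrable (μ := volume).integrable_smul_left_of_hasCompactSupport
      φs.continuous φc
    have i4 := li.integrable_smul_left_of_hasCompactSupport φs.continuous φc
    have e1 : ∫ x, deriv φ x • (Ioi (0 : ℝ)).indicator f x
        = ∫ x in Ioi 0, ((deriv φ x : ℝ) : ℂ) * f x := by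
      rw [← integral_indicator measurableSet_Ioi]
      congr 1
      ext x
      by_cases hx : x ∈ Ioi (0 : ℝ)
      · simp only [indicator_of_mem hx, Complex.real_smul]
      · simp only [indicator_of_notMem hx, smul_zero]
    have e2 : ∫ x in Ioi 0, φ x • (Ioi (0 : ℝ)).indicator g x
        = ∫ x in Ioi 0, ((φ x : ℝ) : ℂ) * g x := by
      refine setIntegral_congr_fun measurableSet_Ioi fun x hx => ?_
      simp only [indicator_of_mem hx, Complex.real_smul]
    have e3 : ∫ x, deriv φ x • G x = ∫ x in Ioi 0, deriv φ x • G x := by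
      symm
      exact setIntegral_eq_integral_of_forall_compl_eq_zero fun x hx => by
        rw [off x hx, zero_smul]
    have hp := (IsPrimitive.of_hasDerivAt
      (fun x => (φs.differentiable (by simp) x).hasDerivAt) φ'c).mul hGp
    have e4 := hp.integral_Ioi i3.integrableOn ((i2.add i4).integrableOn)
    simp only [hφ0, Complex.ofReal_zero, zero_mul, neg_zero] at e4
    have e5 := integral_add (i2.integrableOn (s := Ioi 0)) (i4.integrableOn (s := Ioi 0))
    simp only [Complex.real_smul] at e5 e2 e1 e3
    rw [e4] at e5
    simp only [smul_sub]
    rw [integral_sub i1 i2]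
    simp only [Complex.real_smul]
    rw [e1, e3, h φ φs φc φt]
    rw [e2] at e5
    linear_combination e5
  refine ⟨fun x => c + G x, ?_, ?_⟩
  · filter_upwards [hc, ae_restrict_mem measurableSet_Ioi] with x hx hx0
    rw [indicator_of_mem hx0] at hx
    linear_combination hx
  · refine IsPrimitive.congr_deriv (f := (Ioi (0 : ℝ)).indicator g) ⟨hGp.1, fun x hx => ?_⟩ ind
    rw [hGp.eq_add_integral x hx]
    ring

/-- A continuous function on `[0, ∞)` whose `L²` class has a weak derivative is an indefinite
integral of it. -/
theorem HasWeakDeriv.isPrimitive {f g : L2} (h : HasWeakDeriv f g) {F : ℝ → ℂ}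
    (hF : F =ᵐ[halfLine] f) (hc : ContinuousOn F (Ici 0)) : IsPrimitive F g := by
  obtain ⟨F', hF', hp⟩ := h.exists_isPrimitive
  -- Almost everywhere equality upgrades to equality on the closed half-line by continuity. This
  -- includes x = 0 and so identifies the trace.
  have e : EqOn F F' (Ici 0) := by
    have h1 := (hF.trans hF')
    rw [halfLine, restrict_Ioi_eq_restrict_Ici] at h1
    exact Measure.eqOn_of_ae_eq h1 hc hp.continuousOn (by simp)
  refine ⟨hp.1, fun x hx => ?_⟩
  rw [e hx, e (mem_Ici.2 le_rfl), hp.eq_add_integral x hx]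

/-! ### Bounded weights as multiplication operators on L² -/

/-- A continuous weight that is bounded on the half-line. -/
structure IsWeight (w : ℝ → ℝ) : Prop where
  continuous : Continuous w
  bounded : ∃ C, ∀ x ∈ Ioi (0 : ℝ), |w x| ≤ C

namespace IsWeight

variable {w z : ℝ → ℝ}

theorem const (a : ℝ) : IsWeight fun _ => a := ⟨continuous_const, |a|, fun _ _ => le_rfl⟩

theorem mul (hw : IsWeight w) (hz : IsWeight z) : IsWeight fun x => w x * z x := by
  obtain ⟨C, hC⟩ := hw.bounded
  obtain ⟨D, hD⟩ := hz.bounded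
  refine ⟨hw.continuous.mul hz.continuous, C * D, fun x hx => ?_⟩
  rw [abs_mul]
  exact mul_le_mul (hC x hx) (hD x hx) (abs_nonneg _) ((abs_nonneg _).trans (hC x hx))

theorem sub (hw : IsWeight w) (hz : IsWeight z) : IsWeight fun x => w x - z x := by
  obtain ⟨C, hC⟩ := hw.bounded
  obtain ⟨D, hD⟩ := hz.bounded
  exact ⟨hw.continuous.sub hz.continuous, C + D, fun x hx =>
    (abs_sub _ _).trans (add_le_add (hC x hx) (hD x hx))⟩

theorem memLp_mul (hw : IsWeight w) {F : ℝ → ℂ} (hF : MemLp F 2 halfLine) :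
    MemLp (fun x => (w x : ℂ) * F x) 2 halfLine :=
  IsPrimitive.memLp_continuousOn_mul hw.continuous hw.bounded.choose_spec hF

/-- Multiplication by a bounded weight on `L²(0, ∞)`. -/
noncomputable def mulCLM (hw : IsWeight w) : L2 →L[ℂ] L2 :=
  LinearMap.mkContinuous
    { toFun := fun f => (hw.memLp_mul (Lp.memLp f)).toLp _
      map_add' := fun f g => by
        rw [← MemLp.toLp_add]
        refine MemLp.toLp_congr _ _ ?_
        filter_upwards [Lp.coeFn_add f g] with x hx
        simp only [Pi.add_apply, hx, mul_add]
      map_smul' := fun a f => by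
        rw [RingHom.id_apply, ← MemLp.toLp_const_smul]
        refine MemLp.toLp_congr _ _ ?_
        filter_upwards [Lp.coeFn_smul a f] with x hx
        simp only [Pi.smul_apply, smul_eq_mul, hx]
        ring }
    hw.bounded.choose fun f => by
      refine Lp.norm_le_mul_norm_of_ae_le_mul ?_
      filter_upwards [(hw.memLp_mul (Lp.memLp f)).coeFn_toLp,
        ae_restrict_mem measurableSet_Ioi] with x hx h0
      simp only [LinearMap.coe_mk, AddHom.coe_mk]
      rw [hx, norm_mul, Complex.norm_real, Real.norm_eq_abs]
      exact mul_le_mul_of_nonneg_right (hw.bounded.choose_spec x h0) (norm_nonneg _)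

theorem coeFn_mulCLM (hw : IsWeight w) (f : L2) :
    hw.mulCLM f =ᵐ[halfLine] fun x => (w x : ℂ) * f x :=
  (hw.memLp_mul (Lp.memLp f)).coeFn_toLp

end IsWeight

theorem inner_eq_integral {a b : L2} {A B : ℝ → ℂ} (hA : a =ᵐ[halfLine] A)
    (hB : b =ᵐ[halfLine] B) : inner ℂ a b = ∫ x in Ioi 0, conj (A x) * B x := by
  rw [MeasureTheory.L2.inner_def]
  refine integral_congr_ae ?_
  filter_upwards [hA, hB] with x h1 h2
  rw [h1, h2, RCLike.inner_apply, mul_comm]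

theorem IsWeight.inner_mulCLM {w : ℝ → ℝ} (hw : IsWeight w) {a b : L2} {A B : ℝ → ℂ}
    (hA : a =ᵐ[halfLine] A) (hB : b =ᵐ[halfLine] B) :
    inner ℂ a (hw.mulCLM b) = ∫ x in Ioi 0, conj (A x) * (w x * B x) := by
  refine inner_eq_integral hA ?_
  filter_upwards [hw.coeFn_mulCLM b, hB] with x h1 h2
  rw [h1, h2]

theorem IsWeight.mulCLM_inner {w : ℝ → ℝ} (hw : IsWeight w) (a b : L2) :
    inner ℂ (hw.mulCLM a) b = inner ℂ a (hw.mulCLM b) := by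
  rw [hw.inner_mulCLM (ae_eq_refl _) (ae_eq_refl _),
    inner_eq_integral (hw.coeFn_mulCLM a) (ae_eq_refl _)]
  congr 1
  ext x
  simp only [map_mul, Complex.conj_ofReal]
  ring

theorem IsWeight.mulCLM_mulCLM {w z y : ℝ → ℝ} (hw : IsWeight w) (hz : IsWeight z)
    (hy : IsWeight y) (h : ∀ x, y x = w x * z x) (a : L2) :
    hw.mulCLM (hz.mulCLM a) = hy.mulCLM a := by
  apply Lp.ext
  filter_upwards [hw.coeFn_mulCLM (hz.mulCLM a), hz.coeFn_mulCLM a, hy.coeFn_mulCLM a] with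
    x h1 h2 h3
  rw [h1, h2, h3, h]
  push_cast
  ring

theorem IsWeight.mulCLM_one_sub {w z : ℝ → ℝ} (hw : IsWeight w) (hz : IsWeight z)
    (h : ∀ x, z x = 1 - w x) (a : L2) : hz.mulCLM a = a - hw.mulCLM a := by
  apply Lp.ext
  filter_upwards [hw.coeFn_mulCLM a, hz.coeFn_mulCLM a, Lp.coeFn_sub a (hw.mulCLM a)] with
    x h1 h2 h3
  rw [h2, h3, Pi.sub_apply, h1, h]
  push_cast
  ring

theorem IsWeight.mulCLM_one (hw : IsWeight fun _ => 1) (a : L2) : hw.mulCLM a = a := by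
  apply Lp.ext
  filter_upwards [hw.coeFn_mulCLM a] with x h1
  simp [h1]

theorem IsWeight.mulCLM_zero (hw : IsWeight fun _ => 0) (a : L2) : hw.mulCLM a = 0 := by
  apply Lp.ext
  filter_upwards [hw.coeFn_mulCLM a, Lp.coeFn_zero ℂ 2 halfLine] with x h1 h2
  rw [h1, h2, Complex.ofReal_zero, zero_mul, Pi.zero_apply]

/-- A continuously differentiable weight, bounded on the half-line with its derivative. -/
structure IsC1Weight (w w' : ℝ → ℝ) : Prop where
  hasDerivAt : ∀ x, HasDerivAt w (w' x) x
  weight : IsWeight w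
  weight_deriv : IsWeight w'

theorem IsC1Weight.one : IsC1Weight (fun _ => 1) (fun _ => 0) :=
  ⟨fun x => hasDerivAt_const x 1, .const 1, .const 0⟩

/-! ### Integration by parts, trace and supremum bounds in L² -/

section parts

variable {a a' b b' : L2} {A A' B B' : ℝ → ℂ}

/-- Weighted integration by parts in terms of the inner product of `L²(0, ∞)`. -/
theorem IsPrimitive.inner_weight (hA : IsPrimitive A A') (hB : IsPrimitive B B')
    (ha : a =ᵐ[halfLine] A) (ha' : a' =ᵐ[halfLine] A')
    (hb : b =ᵐ[halfLine] B) (hb' : b' =ᵐ[halfLine] B') {w w' : ℝ → ℝ} (hw : IsC1Weight w w') :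
    inner ℂ a (hw.weight_deriv.mulCLM b) + inner ℂ a' (hw.weight.mulCLM b)
      + inner ℂ a (hw.weight.mulCLM b') = - (conj (A 0) * (w 0 * B 0)) := by
  rw [hw.weight_deriv.inner_mulCLM ha hb, hw.weight.inner_mulCLM ha' hb,
    hw.weight.inner_mulCLM ha hb']
  obtain ⟨C, hC⟩ := hw.weight.bounded
  obtain ⟨C', hC'⟩ := hw.weight_deriv.bounded
  exact hA.integral_weight hB ((memLp_congr_ae ha).1 (Lp.memLp a))
    ((memLp_congr_ae ha').1 (Lp.memLp a')) ((memLp_congr_ae hb).1 (Lp.memLp b))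
    ((memLp_congr_ae hb').1 (Lp.memLp b')) hw.hasDerivAt hw.weight_deriv.continuous hC hC'

/-- Integration by parts in terms of the inner product of `L²(0, ∞)`. -/
theorem IsPrimitive.inner_parts (hA : IsPrimitive A A') (hB : IsPrimitive B B')
    (ha : a =ᵐ[halfLine] A) (ha' : a' =ᵐ[halfLine] A')
    (hb : b =ᵐ[halfLine] B) (hb' : b' =ᵐ[halfLine] B') :
    inner ℂ a' b + inner ℂ a b' = - (conj (A 0) * B 0) := by
  have := hA.inner_weight hB ha ha' hb hb' IsC1Weight.one
  simpa only [IsWeight.mulCLM_one, IsWeight.mulCLM_zero, inner_zero_right, zero_add,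
    Complex.ofReal_one, one_mul] using this

theorem norm_sq_eq_integral (ha : a =ᵐ[halfLine] A) : ‖a‖ ^ 2 = ∫ x in Ioi 0, ‖A x‖ ^ 2 := by
  have h1 : ((‖a‖ ^ 2 : ℝ) : ℂ) = inner ℂ a a := by
    rw [inner_self_eq_norm_sq_to_K]; push_cast; rfl
  rw [inner_eq_integral ha ha] at h1
  have h2 : ∫ x in Ioi 0, conj (A x) * A x = ((∫ x in Ioi 0, ‖A x‖ ^ 2 : ℝ) : ℂ) := by
    rw [← integral_complex_ofReal]
    congr 1
    ext x
    rw [mul_comm, Complex.mul_conj, Complex.normSq_eq_norm_sq]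
  exact_mod_cast h1.trans h2

theorem integrable_norm_sq (ha : a =ᵐ[halfLine] A) :
    IntegrableOn (fun x => ‖A x‖ ^ 2) (Ioi 0) :=
  ((memLp_congr_ae ha).1 (Lp.memLp a)).norm.integrable_sq

/-- The trace at the boundary is controlled by the `H¹` norm. -/
theorem IsPrimitive.norm_zero_sq_le (hA : IsPrimitive A A')
    (ha : a =ᵐ[halfLine] A) (ha' : a' =ᵐ[halfLine] A') :
    ‖A 0‖ ^ 2 ≤ ‖a‖ ^ 2 + ‖a'‖ ^ 2 := by
  have h := hA.inner_parts hA ha ha' ha ha'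
  have h2 : ((‖A 0‖ ^ 2 : ℝ) : ℂ) = - (inner ℂ a' a + inner ℂ a a') := by
    rw [h, neg_neg, mul_comm, Complex.mul_conj, Complex.normSq_eq_norm_sq]
  have h3 : ‖A 0‖ ^ 2 = ‖inner ℂ a' a + inner ℂ a a'‖ := by
    rw [← norm_neg (inner ℂ a' a + _), ← h2, Complex.norm_real, Real.norm_of_nonneg (by positivity)]
  have h4 := norm_add_le (inner ℂ a' a) (inner ℂ a a')
  have h5 := norm_inner_le_norm (𝕜 := ℂ) a' a
  have h6 := norm_inner_le_norm (𝕜 := ℂ) a a'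
  nlinarith [sq_nonneg (‖a‖ - ‖a'‖)]

/-- The supremum is controlled by the `H¹` norm. -/
theorem IsPrimitive.norm_sq_le (hA : IsPrimitive A A')
    (ha : a =ᵐ[halfLine] A) (ha' : a' =ᵐ[halfLine] A') {x : ℝ} (hx : 0 ≤ x) :
    ‖A x‖ ^ 2 ≤ 2 * (‖a‖ ^ 2 + ‖a'‖ ^ 2) := by
  have h := (hA.conjugate.mul hA).eq_add_integral x hx
  have sq : ∀ y, ‖conj (A y) * A y‖ = ‖A y‖ ^ 2 := fun y => by
    rw [norm_mul, RCLike.norm_conj, sq]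
  have h1 : ‖∫ y in 0..x, (conj (A' y) * A y + conj (A y) * A' y)‖
      ≤ ∫ y in Ioi 0, (‖A y‖ ^ 2 + ‖A' y‖ ^ 2) := by
    have i := (integrable_norm_sq ha).add (integrable_norm_sq ha')
    rw [intervalIntegral.integral_of_le hx]
    refine (norm_integral_le_of_norm_le (i.mono_set Ioc_subset_Ioi_self)
      (.of_forall fun y => ?_)).trans
      (setIntegral_mono_set i (.of_forall fun y => add_nonneg (sq_nonneg ‖A y‖) (sq_nonneg ‖A' y‖))
        Ioc_subset_Ioi_self.eventuallyLE)
    refine (norm_add_le _ _).trans ?_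
    simp only [norm_mul, RCLike.norm_conj, Pi.add_apply]
    nlinarith [sq_nonneg (‖A y‖ - ‖A' y‖)]
  rw [integral_add (integrable_norm_sq ha) (integrable_norm_sq ha'), ← norm_sq_eq_integral ha,
    ← norm_sq_eq_integral ha'] at h1
  have h2 := norm_add_le (conj (A 0) * A 0) (∫ y in 0..x, (conj (A' y) * A y + conj (A y) * A' y))
  rw [← h, sq, sq] at h2
  linarith [hA.norm_zero_sq_le ha ha']

end parts

/-! ### Strong solutions and the differentiation principle -/

/-- Differentiation of a functional whose increments are expressed by inner products of the
increments of differentiable curves with continuous curves. -/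
theorem hasDerivAt_of_inner_increment {L : ℂ →L[ℝ] ℝ} {u k : ℝ → L2} {u' : L2} {b h : ℝ → ℂ}
    {b' : ℂ} {F : ℝ → ℝ} {t : ℝ} (hu : HasDerivAt u u' t) (hk : ContinuousAt k t)
    (hb : HasDerivAt b b' t) (hh : ContinuousAt h t)
    (hF : ∀ᶠ s in 𝓝 t, F s - F t
      = L (inner ℂ (u s - u t) (k s)) + L (conj (b s - b t) * h s)) :
    HasDerivAt F (L (inner ℂ u' (k t)) + L (conj b' * h t)) t := by
  rw [hasDerivAt_iff_tendsto_slope] at hu hb ⊢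
  -- Only `u` and `b` enter through difference quotients; for `k` and `h` continuity at `t` is
  -- enough.
  have l1 : Tendsto (fun s => L (inner ℂ (slope u t s) (k s))) (𝓝[≠] t)
      (𝓝 (L (inner ℂ u' (k t)))) :=
    (L.continuous.tendsto _).comp (hu.inner (hk.tendsto.mono_left nhdsWithin_le_nhds))
  have l2 : Tendsto (fun s => L (conj (slope b t s) * h s)) (𝓝[≠] t)
      (𝓝 (L (conj b' * h t))) :=
    (L.continuous.tendsto _).comp (((Complex.continuous_conj.tendsto _).comp hb).mul
      (hh.tendsto.mono_left nhdsWithin_le_nhds))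
  refine (l1.add l2).congr' ?_
  filter_upwards [hF.filter_mono nhdsWithin_le_nhds] with s hs
  rw [slope_def_module, slope_def_module, slope_def_module, hs, smul_add]
  congr 1
  · rw [show ((s - t)⁻¹ • (u s - u t) : L2) = (((s - t)⁻¹ : ℝ) : ℂ) • (u s - u t) from
      (RCLike.real_smul_eq_coe_smul (K := ℂ) _ _), inner_smul_left, Complex.conj_ofReal,
      ← Complex.real_smul, map_smul]
  · rw [Complex.real_smul, map_mul conj, Complex.conj_ofReal, mul_assoc, ← Complex.real_smul,
      map_smul]

theorem memLp_mul_of_norm_le {f : L2} {F G : ℝ → ℂ} (hf : f =ᵐ[halfLine] F)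
    (hG : ContinuousOn G (Ici 0)) {C : ℝ} (hC : ∀ x, 0 ≤ x → ‖G x‖ ≤ C) :
    MemLp (fun x => G x * F x) 2 halfLine := by
  have hF := (memLp_congr_ae hf).1 (Lp.memLp f)
  refine hF.of_le_mul (c := C)
    (((hG.mono Ioi_subset_Ici_self).aestronglyMeasurable measurableSet_Ioi).mul hF.1) ?_
  filter_upwards [ae_restrict_mem measurableSet_Ioi] with x hx
  rw [norm_mul]
  exact mul_le_mul_of_nonneg_right (hC x (le_of_lt hx)) (norm_nonneg _)

/-- A solution `v t x` with its space derivative `p t x`, together with the curves in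
`L²(0, ∞)` of the classes of `v`, `v_x`, `v_xx`, `|v|² v` and `v_t`. -/
structure IsStrongSolution (v p : ℝ → ℝ → ℂ) (u ux uxx c du : ℝ → L2) : Prop where
  u_ae : ∀ t, 0 ≤ t → u t =ᵐ[halfLine] v t
  ux_ae : ∀ t, 0 ≤ t → ux t =ᵐ[halfLine] p t
  cubic_ae : ∀ t, 0 ≤ t → c t =ᵐ[halfLine] fun x => ((‖v t x‖ ^ 2 : ℝ) : ℂ) * v t x
  primitive_u : ∀ t, 0 ≤ t → IsPrimitive (v t) (p t)
  primitive_ux : ∀ t, 0 ≤ t → IsPrimitive (p t) (uxx t)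
  continuousOn_u : ContinuousOn u (Ici 0)
  continuousOn_ux : ContinuousOn ux (Ici 0)
  continuousOn_uxx : ContinuousOn uxx (Ici 0)
  hasDerivAt : ∀ t, 0 < t → HasDerivAt u (du t) t
  equation : ∀ t, 0 < t → du t = Complex.I • (uxx t - (2 : ℂ) • c t)

/-- Weak derivatives become indefinite integrals, which gives `q_x` a pointwise representative and a
trace. The sup bound from H¹ puts the cubic term in L². -/
theorem IsSolution.exists_isStrongSolution {q₀ Q : ℝ → ℂ} {q : ℝ → ℝ → ℂ}
    (hq : IsSolution q₀ Q q) :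
    ∃ p u ux uxx c du, IsStrongSolution (fun t x => q x t) p u ux uxx c du := by
  obtain ⟨u, ux, uxx, hu, hC1, hw, hw', cu, cux, cuxx, heq⟩ := hq.regularity_and_equation
  -- Nothing is known at negative times; the value 0 there only makes the choice of `p` total.
  have hp : ∀ t, ∃ F : ℝ → ℂ, 0 ≤ t → ux t =ᵐ[halfLine] F ∧ IsPrimitive F (uxx t) := fun t => by
    by_cases ht : 0 ≤ t
    · obtain ⟨F, hF⟩ := (hw' t ht).exists_isPrimitive
      exact ⟨F, fun _ => hF⟩
    · exact ⟨0, fun h => absurd h ht⟩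
  choose p hp using hp
  have prim : ∀ t, 0 ≤ t → IsPrimitive (fun x => q x t) (p t) := fun t ht =>
    ((hw t ht).isPrimitive (hu t ht) (hq.continuousOn_space t ht)).congr_deriv (hp t ht).1
  have hc : ∀ t, ∃ c : L2, 0 ≤ t →
      c =ᵐ[halfLine] fun x => ((‖q x t‖ ^ 2 : ℝ) : ℂ) * q x t := fun t => by
    by_cases ht : 0 ≤ t
    · have hcont := hq.continuousOn_space t ht
      have := memLp_mul_of_norm_le (hu t ht).symm (G := fun x => ((‖q x t‖ ^ 2 : ℝ) : ℂ))
        (Complex.continuous_ofReal.comp_continuousOn (hcont.norm.pow 2))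
        (C := 2 * (‖u t‖ ^ 2 + ‖ux t‖ ^ 2)) fun x hx => by
          rw [Complex.norm_real, Real.norm_of_nonneg (by positivity)]
          exact (prim t ht).norm_sq_le (hu t ht).symm (hp t ht).1 hx
      exact ⟨this.toLp _, fun _ => this.coeFn_toLp⟩
    · exact ⟨0, fun h => absurd h ht⟩
  choose c hc using hc
  refine ⟨p, u, ux, uxx, c, fun t => derivWithin u (Ici 0) t, fun t ht => (hu t ht).symm,
    fun t ht => (hp t ht).1, hc, prim, fun t ht => (hp t ht).2, cu, cux, cuxx, ?_, ?_⟩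
  · intro t ht
    exact ((hC1.differentiableOn (by simp) t ht.le).hasDerivWithinAt).hasDerivAt (Ici_mem_nhds ht)
  · intro t ht
    apply Lp.ext
    filter_upwards [heq t ht, hc t ht.le,
      Lp.coeFn_smul Complex.I (uxx t - (2 : ℂ) • c t), Lp.coeFn_sub (uxx t) ((2 : ℂ) • c t),
      Lp.coeFn_smul (2 : ℂ) (c t)] with x h1 h2 h3 h4 h5
    rw [h3, Pi.smul_apply, h4, Pi.sub_apply, h5, Pi.smul_apply, h2]
    simp only [smul_eq_mul]
    linear_combination (-Complex.I) * h1 +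
      (derivWithin u (Ici 0) t : L2) x * Complex.I_mul_I

theorem IsWeight.inner_mulCLM_symm {w : ℝ → ℝ} (hw : IsWeight w) (a b : L2) :
    inner ℂ a (hw.mulCLM b) = conj (inner ℂ b (hw.mulCLM a)) := by
  rw [← hw.mulCLM_inner a b, inner_conj_symm]

theorem IsWeight.inner_mulCLM_self_im {w : ℝ → ℝ} (hw : IsWeight w) (a : L2) :
    (inner ℂ a (hw.mulCLM a)).im = 0 :=
  Complex.conj_eq_iff_im.1 (hw.inner_mulCLM_symm a a).symm

/-! ### Evolution laws of mass, momentum and energy -/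

namespace IsStrongSolution

variable {v p : ℝ → ℝ → ℂ} {u ux uxx c du : ℝ → L2}

theorem continuousAt_u (h : IsStrongSolution v p u ux uxx c du) {t : ℝ} (ht : 0 < t) :
    ContinuousAt u t :=
  h.continuousOn_u.continuousAt (Ici_mem_nhds ht)

theorem continuousAt_ux (h : IsStrongSolution v p u ux uxx c du) {t : ℝ} (ht : 0 < t) :
    ContinuousAt ux t :=
  h.continuousOn_ux.continuousAt (Ici_mem_nhds ht)

theorem continuousAt_uxx (h : IsStrongSolution v p u ux uxx c du) {t : ℝ} (ht : 0 < t) :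
    ContinuousAt uxx t :=
  h.continuousOn_uxx.continuousAt (Ici_mem_nhds ht)

theorem eventually_nonneg {t : ℝ} (ht : 0 < t) : ∀ᶠ s in 𝓝 t, 0 ≤ s :=
  (eventually_gt_nhds ht).mono fun _ hs => hs.le

theorem sub_ae (h : IsStrongSolution v p u ux uxx c du) {s t : ℝ} (hs : 0 ≤ s) (ht : 0 ≤ t) :
    (u s - u t : L2) =ᵐ[halfLine] fun x => v s x - v t x := by
  filter_upwards [h.u_ae s hs, h.u_ae t ht, Lp.coeFn_sub (u s) (u t)] with x h1 h2 h3
  rw [h3, Pi.sub_apply, h1, h2]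

theorem sub_ux_ae (h : IsStrongSolution v p u ux uxx c du) {s t : ℝ} (hs : 0 ≤ s)
    (ht : 0 ≤ t) : (ux s - ux t : L2) =ᵐ[halfLine] fun x => p s x - p t x := by
  filter_upwards [h.ux_ae s hs, h.ux_ae t ht, Lp.coeFn_sub (ux s) (ux t)] with x h1 h2 h3
  rw [h3, Pi.sub_apply, h1, h2]

theorem norm_v_sq_le (h : IsStrongSolution v p u ux uxx c du) {t : ℝ} (ht : 0 ≤ t) {x : ℝ}
    (hx : 0 ≤ x) : ‖v t x‖ ^ 2 ≤ 2 * (‖u t‖ ^ 2 + ‖ux t‖ ^ 2) :=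
  (h.primitive_u t ht).norm_sq_le (h.u_ae t ht) (h.ux_ae t ht) hx

/-- The trace of the space derivative depends continuously on time. -/
theorem continuousAt_trace (h : IsStrongSolution v p u ux uxx c du) {t : ℝ} (ht : 0 < t) :
    ContinuousAt (fun s => p s 0) t := by
  have l1 : Tendsto (fun s => ‖ux s - ux t‖ ^ 2 + ‖uxx s - uxx t‖ ^ 2) (𝓝 t) (𝓝 0) := by
    have : ContinuousAt (fun s => ‖ux s - ux t‖ ^ 2 + ‖uxx s - uxx t‖ ^ 2) t :=
      ((((h.continuousAt_ux ht).sub (continuousAt_const (y := ux t))).norm.pow 2).add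
      (((h.continuousAt_uxx ht).sub (continuousAt_const (y := uxx t))).norm.pow 2))
    simpa using this.tendsto
  have l2 : Tendsto (fun s => ‖p s 0 - p t 0‖ ^ 2) (𝓝 t) (𝓝 0) := by
    refine squeeze_zero' (.of_forall fun s => by positivity) ?_ l1
    filter_upwards [eventually_nonneg ht] with s hs
    exact ((h.primitive_ux s hs).sub (h.primitive_ux t ht.le)).norm_zero_sq_le
      (h.sub_ux_ae hs ht.le) (Lp.coeFn_sub _ _)
  have l3 := (Real.continuous_sqrt.tendsto _).comp l2
  simp only [Function.comp_def, Real.sqrt_sq (norm_nonneg _), Real.sqrt_zero] at l3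
  exact tendsto_iff_norm_sub_tendsto_zero.2 l3

/-- The pairing is real, which removes the nonlinearity from the mass law, and it turns the cubic
term into a weighted quartic integral. -/
theorem inner_cubic (h : IsStrongSolution v p u ux uxx c du) {t : ℝ} (ht : 0 ≤ t)
    {w : ℝ → ℝ} (hw : IsWeight w) :
    inner ℂ (c t) (hw.mulCLM (u t)) = ((∫ x in Ioi 0, w x * ‖v t x‖ ^ 4 : ℝ) : ℂ) := by
  rw [hw.inner_mulCLM (h.cubic_ae t ht) (h.u_ae t ht), ← integral_complex_ofReal]
  congr 1
  ext x
  rw [map_mul, Complex.conj_ofReal]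
  have : conj (v t x) * v t x = ((‖v t x‖ ^ 2 : ℝ) : ℂ) := by
    rw [mul_comm, Complex.mul_conj, Complex.normSq_eq_norm_sq]
  calc _ = ((‖v t x‖ ^ 2 : ℝ) : ℂ) * w x * (conj (v t x) * v t x) := by ring
    _ = _ := by rw [this]; push_cast; ring

theorem inner_du (h : IsStrongSolution v p u ux uxx c du) {t : ℝ} (ht : 0 < t) (k : L2) :
    inner ℂ (du t) k = -Complex.I * (inner ℂ (uxx t) k - 2 * inner ℂ (c t) k) := by
  rw [h.equation t ht, inner_smul_left, inner_sub_left, inner_smul_left, Complex.conj_I, map_ofNat]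

/-- Evolution of the weighted mass. -/
theorem hasDerivAt_mass (h : IsStrongSolution v p u ux uxx c du) {w w' : ℝ → ℝ}
    (hw : IsC1Weight w w') {t : ℝ} (ht : 0 < t) :
    HasDerivAt (fun s => (inner ℂ (u s) (hw.weight.mulCLM (u s))).re)
      (2 * (inner ℂ (u t) (hw.weight_deriv.mulCLM (ux t))).im
        + 2 * w 0 * (conj (v t 0) * p t 0).im) t := by
  -- By symmetry of the weighted form, the increment is Re⟨u s − u t, w(u s + u t)⟩. No boundary
  -- increment occurs, so that slot is filled with zeros.
  have key := hasDerivAt_of_inner_increment (L := Complex.reCLM) (h.hasDerivAt t ht)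
    (k := fun s => hw.weight.mulCLM (u s + u t))
    (F := fun s => (inner ℂ (u s) (hw.weight.mulCLM (u s))).re)
    (hw.weight.mulCLM.continuous.continuousAt.comp ((h.continuousAt_u ht).add continuousAt_const))
    (hasDerivAt_const t (0 : ℂ)) (continuousAt_const (y := (0 : ℂ))) (.of_forall fun s => by
      have := congrArg Complex.re (hw.weight.inner_mulCLM_symm (u s) (u t))
      rw [Complex.conj_re] at this
      simp only [map_add, inner_add_right, inner_sub_left, Complex.reCLM_apply,
        Complex.sub_re, sub_self, map_zero, zero_mul]
      linarith)
  convert key using 1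
  have hp := (h.primitive_ux t ht.le).inner_weight (h.primitive_u t ht.le) (h.ux_ae t ht.le)
    (ae_eq_refl _) (h.u_ae t ht.le) (h.ux_ae t ht.le) hw
  have e1 := congrArg Complex.im hp
  have e2 := hw.weight.inner_mulCLM_self_im (ux t)
  have e3 := congrArg Complex.im (hw.weight_deriv.inner_mulCLM_symm (ux t) (u t))
  have e4 : (inner ℂ (c t) (hw.weight.mulCLM (u t))).im = 0 := by
    rw [h.inner_cubic ht.le hw.weight, Complex.ofReal_im]
  rw [Complex.conj_im] at e3
  simp only [Complex.add_im, Complex.neg_im, Complex.mul_im, Complex.conj_re, Complex.conj_im,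
    Complex.ofReal_re, Complex.ofReal_im, Complex.mul_re] at e1
  simp only [map_add, inner_add_right, h.inner_du ht, Complex.reCLM_apply, Complex.add_re,
    Complex.mul_re, Complex.neg_re, Complex.I_re, Complex.neg_im, Complex.I_im, Complex.sub_re,
    Complex.sub_im, Complex.mul_im, Complex.conj_re, Complex.conj_im, map_zero, zero_mul,
    Complex.re_ofNat, Complex.im_ofNat, Complex.add_im]
  linarith

/-- Weighted integration by parts for the quartic density. -/
theorem inner_cubic_parts (h : IsStrongSolution v p u ux uxx c du) {w w' : ℝ → ℝ}
    (hw : IsC1Weight w w') {t : ℝ} (ht : 0 ≤ t) :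
    4 * (inner ℂ (c t) (hw.weight.mulCLM (ux t))).re
      + (inner ℂ (c t) (hw.weight_deriv.mulCLM (u t))).re = - (w 0 * ‖v t 0‖ ^ 4) := by
  have hv := h.primitive_u t ht
  have hbd : ∀ x, 0 ≤ x → ‖v t x‖ ≤ √(2 * (‖u t‖ ^ 2 + ‖ux t‖ ^ 2)) := fun x hx =>
    Real.le_sqrt_of_sq_le (h.norm_v_sq_le ht hx)
  have hsq : ∀ x, conj (v t x) * v t x = ((‖v t x‖ ^ 2 : ℝ) : ℂ) := fun x => by
    rw [mul_comm, Complex.mul_conj, Complex.normSq_eq_norm_sq]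
  have m1 := memLp_mul_of_norm_le (h.u_ae t ht) hv.conjugate.continuousOn
    (fun x hx => (RCLike.norm_conj (v t x)).trans_le (hbd x hx))
  have m2 := memLp_mul_of_norm_le (h.ux_ae t ht) hv.conjugate.continuousOn
    (fun x hx => (RCLike.norm_conj (v t x)).trans_le (hbd x hx))
  have m3 : MemLp (fun x => conj (p t x) * v t x + conj (v t x) * p t x) 2 halfLine := by
    refine MemLp.add ?_ m2
    refine m2.star.congr_norm ?_ (.of_forall fun x => ?_)
    · exact ((memLp_congr_ae (h.ux_ae t ht)).1 (Lp.memLp _)).star.1.mul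
        ((memLp_congr_ae (h.u_ae t ht)).1 (Lp.memLp _)).1
    · simp [mul_comm]
  -- Integration by parts of |v|² against itself: its derivative is 2 Re(v̄ v_x), and the two equal
  -- cross terms give the factor 4.
  have key := (hv.conjugate.mul hv).inner_weight (hv.conjugate.mul hv) m1.coeFn_toLp
    m3.coeFn_toLp m1.coeFn_toLp m3.coeFn_toLp hw
  have e1 := congrArg Complex.re key
  have e2 := congrArg Complex.re (hw.weight.inner_mulCLM_symm (m3.toLp _) (m1.toLp _))
  have e3 : inner ℂ (m1.toLp _) (hw.weight_deriv.mulCLM (m1.toLp _))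
      = inner ℂ (c t) (hw.weight_deriv.mulCLM (u t)) := by
    rw [hw.weight_deriv.inner_mulCLM m1.coeFn_toLp m1.coeFn_toLp,
      hw.weight_deriv.inner_mulCLM (h.cubic_ae t ht) (h.u_ae t ht)]
    congr 1
    ext x
    rw [hsq, map_mul, Complex.conj_ofReal, ← hsq]
    ring
  have e4 : inner ℂ (m1.toLp _) (hw.weight.mulCLM (m3.toLp _))
      = inner ℂ (c t) (hw.weight.mulCLM (ux t)) + inner ℂ (ux t) (hw.weight.mulCLM (c t)) := by
    have mc := (memLp_congr_ae (h.cubic_ae t ht)).1 (Lp.memLp _)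
    have mx := (memLp_congr_ae (h.ux_ae t ht)).1 (Lp.memLp _)
    rw [hw.weight.inner_mulCLM m1.coeFn_toLp m3.coeFn_toLp,
      hw.weight.inner_mulCLM (h.cubic_ae t ht) (h.ux_ae t ht),
      hw.weight.inner_mulCLM (h.ux_ae t ht) (h.cubic_ae t ht),
      ← integral_add (mc.integrable_conj_mul (hw.weight.memLp_mul mx))
        (mx.integrable_conj_mul (hw.weight.memLp_mul mc))]
    congr 1
    ext x
    rw [hsq, map_mul, Complex.conj_ofReal]
    ring
  have e5 := congrArg Complex.re (hw.weight.inner_mulCLM_symm (ux t) (c t))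
  rw [e3, Complex.add_re, Complex.add_re, e2, Complex.conj_re, e4, Complex.add_re, e5,
    Complex.conj_re, hsq, Complex.conj_ofReal, ← Complex.ofReal_mul, ← Complex.ofReal_mul,
    Complex.neg_re, Complex.ofReal_re] at e1
  linarith

/-- Evolution of the weighted momentum. -/
theorem hasDerivAt_momentum (h : IsStrongSolution v p u ux uxx c du) {w w' w'' : ℝ → ℝ}
    (hw : IsC1Weight w w') (hw' : IsC1Weight w' w'') {t : ℝ} (ht : 0 < t) {b' : ℂ}
    (hb : HasDerivAt (fun s => v s 0) b' t) :
    HasDerivAt (fun s => (inner ℂ (u s) (hw.weight.mulCLM (ux s))).im)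
      (2 * (inner ℂ (ux t) (hw'.weight.mulCLM (ux t))).re
        + (inner ℂ (ux t) (hw'.weight_deriv.mulCLM (u t))).re
        + (inner ℂ (c t) (hw'.weight.mulCLM (u t))).re
        + w' 0 * (conj (p t 0) * v t 0).re
        + w 0 * (‖p t 0‖ ^ 2 - ‖v t 0‖ ^ 4 - (conj (v t 0) * b').im)) t := by
  -- The increment of `ux` is moved onto `u` by parts. This produces the second copy of `w ux`, the
  -- term `w' u` and the boundary increment.
  have key := hasDerivAt_of_inner_increment (L := Complex.imCLM) (h.hasDerivAt t ht)
    (k := fun s => hw.weight.mulCLM (ux s + ux t) + hw'.weight.mulCLM (u t))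
    (F := fun s => (inner ℂ (u s) (hw.weight.mulCLM (ux s))).im)
    (((hw.weight.mulCLM.continuous.continuousAt.comp
      ((h.continuousAt_ux ht).add continuousAt_const))).add continuousAt_const)
    hb (continuousAt_const (y := (w 0 : ℂ) * v t 0)) (by
      filter_upwards [eventually_nonneg ht] with s hs
      have hp := (h.primitive_u t ht.le).inner_weight
        ((h.primitive_u s hs).sub (h.primitive_u t ht.le)) (h.u_ae t ht.le)
        (h.ux_ae t ht.le) (h.sub_ae hs ht.le) (h.sub_ux_ae hs ht.le) hw
      have e1 := congrArg Complex.im hp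
      have e2 := congrArg Complex.im (hw.weight_deriv.inner_mulCLM_symm (u t) (u s - u t))
      have e3 := congrArg Complex.im (hw.weight.inner_mulCLM_symm (ux t) (u s - u t))
      rw [Complex.conj_im] at e2 e3
      simp only [map_add, map_sub, inner_add_right, inner_sub_left, inner_sub_right,
        Complex.imCLM_apply, Complex.add_im, Complex.sub_im, Complex.neg_im, Complex.mul_im,
        Complex.sub_re, Complex.conj_re, Complex.conj_im, Complex.ofReal_re, Complex.ofReal_im,
        Complex.mul_re] at e1 e2 e3 ⊢
      linarith)
  convert key using 1
  -- `p1` handles the pairing of `w ux` with `uxx` and yields the boundary term |p|²; `p2` handles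
  -- the pairing of `w' u` with `uxx`.
  have p1 := (h.primitive_ux t ht.le).inner_weight (h.primitive_ux t ht.le) (h.ux_ae t ht.le)
    (ae_eq_refl _) (h.ux_ae t ht.le) (ae_eq_refl _) hw
  have p2 := (h.primitive_ux t ht.le).inner_weight (h.primitive_u t ht.le) (h.ux_ae t ht.le)
    (ae_eq_refl _) (h.u_ae t ht.le) (h.ux_ae t ht.le) hw'
  have e1 := congrArg Complex.re p1
  have e2 := congrArg Complex.re p2
  have e3 := congrArg Complex.re (hw.weight.inner_mulCLM_symm (ux t) (uxx t))
  have e4 := h.inner_cubic_parts hw ht.le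
  have e5 : ‖p t 0‖ ^ 2 = (p t 0).re * (p t 0).re + (p t 0).im * (p t 0).im := by
    rw [← Complex.normSq_eq_norm_sq, Complex.normSq_apply]
  rw [Complex.conj_re] at e3
  simp only [Complex.add_re, Complex.neg_re, Complex.mul_re, Complex.conj_re, Complex.conj_im,
    Complex.ofReal_re, Complex.ofReal_im, Complex.mul_im] at e1 e2
  simp only [map_add, inner_add_right, h.inner_du ht, Complex.imCLM_apply, Complex.add_im,
    Complex.mul_re, Complex.neg_re, Complex.I_re, Complex.neg_im, Complex.I_im, Complex.sub_re,
    Complex.sub_im, Complex.mul_im, Complex.conj_re, Complex.conj_im, Complex.add_re,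
    Complex.re_ofNat, Complex.im_ofNat, Complex.ofReal_re, Complex.ofReal_im]
  rw [e5]
  linarith

/-- Evolution of the kinetic energy. -/
theorem hasDerivAt_kinetic (h : IsStrongSolution v p u ux uxx c du) {t : ℝ} (ht : 0 < t) {b' : ℂ}
    (hb : HasDerivAt (fun s => v s 0) b' t) :
    HasDerivAt (fun s => ‖ux s‖ ^ 2)
      (-2 * (inner ℂ (du t) (uxx t)).re - 2 * (conj b' * p t 0).re) t := by
  -- The difference of squares is Re⟨ux s − ux t, ux s + ux t⟩; integrating by parts puts the
  -- derivative on the sum, and continuity of the trace of `q_x` controls the boundary part.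
  have key := hasDerivAt_of_inner_increment (L := Complex.reCLM) (h.hasDerivAt t ht)
    (k := fun s => -(uxx s + uxx t)) (F := fun s => ‖ux s‖ ^ 2)
    (((h.continuousAt_uxx ht).add continuousAt_const).neg)
    hb (h := fun s => -(p s 0 + p t 0))
    (((h.continuousAt_trace ht).add (continuousAt_const (y := p t 0))).neg) (by
      filter_upwards [eventually_nonneg ht] with s hs
      have hp := ((h.primitive_u s hs).sub (h.primitive_u t ht.le)).inner_parts
        ((h.primitive_ux s hs).add (h.primitive_ux t ht.le)) (h.sub_ae hs ht.le)
        (h.sub_ux_ae hs ht.le) (b := ux s + ux t) (b' := uxx s + uxx t)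
        (by filter_upwards [h.ux_ae s hs, h.ux_ae t ht.le, Lp.coeFn_add (ux s) (ux t)] with
              x h1 h2 h3
            rw [h3, Pi.add_apply, h1, h2])
        (Lp.coeFn_add _ _)
      have e1 := congrArg Complex.re hp
      have e2 := congrArg Complex.re (inner_conj_symm (𝕜 := ℂ) (ux s) (ux t))
      have n : ∀ s, ‖ux s‖ ^ 2 = (inner ℂ (ux s) (ux s)).re := fun s =>
        (inner_self_eq_norm_sq (𝕜 := ℂ) (ux s)).symm
      rw [Complex.conj_re] at e2
      rw [n, n]
      simp only [map_sub, inner_add_right, inner_sub_left, inner_neg_right, Complex.reCLM_apply,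
        Complex.add_re, Complex.sub_re, Complex.neg_re, Complex.mul_re, Complex.sub_im,
        Complex.conj_re, Complex.conj_im, Complex.add_im, Complex.neg_im] at e1 ⊢
      linarith)
  convert key using 1
  simp only [inner_add_right, inner_neg_right, Complex.reCLM_apply, Complex.add_re,
    Complex.neg_re, Complex.mul_re, Complex.conj_re, Complex.conj_im, Complex.neg_im,
    Complex.add_im]
  ring

/-- Evolution of the potential energy. -/
theorem hasDerivAt_potential (h : IsStrongSolution v p u ux uxx c du) {t : ℝ} (ht : 0 < t) :
    HasDerivAt (fun s => (inner ℂ (u s) (c s)).re) (4 * (inner ℂ (du t) (c t)).re) t := by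
  -- This comes from the factorisation |a|⁴ − |b|⁴ = Re(conj(a − b)(|a|² + |b|²)(a + b)).
  have hk : ∀ s, ∃ k : L2, 0 ≤ s → k =ᵐ[halfLine] fun x =>
      ((‖v s x‖ ^ 2 + ‖v t x‖ ^ 2 : ℝ) : ℂ) * (v s x + v t x) := fun s => by
    by_cases hs : 0 ≤ s
    · have ae : (u s + u t : L2) =ᵐ[halfLine] fun x => v s x + v t x := by
        filter_upwards [h.u_ae s hs, h.u_ae t ht.le, Lp.coeFn_add (u s) (u t)] with x h1 h2 h3
        rw [h3, Pi.add_apply, h1, h2]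
      have := memLp_mul_of_norm_le ae (G := fun x => ((‖v s x‖ ^ 2 + ‖v t x‖ ^ 2 : ℝ) : ℂ))
        (Complex.continuous_ofReal.comp_continuousOn
          (((h.primitive_u s hs).continuousOn.norm.pow 2).add
            ((h.primitive_u t ht.le).continuousOn.norm.pow 2)))
        (C := 2 * (‖u s‖ ^ 2 + ‖ux s‖ ^ 2) + 2 * (‖u t‖ ^ 2 + ‖ux t‖ ^ 2)) fun x hx => by
          rw [Complex.norm_real, Real.norm_of_nonneg (by positivity)]
          exact add_le_add (h.norm_v_sq_le hs hx) (h.norm_v_sq_le ht.le hx)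
      exact ⟨this.toLp _, fun _ => this.coeFn_toLp⟩
    · exact ⟨0, fun h => absurd h hs⟩
  choose k hk using hk
  have hkt : k t = (4 : ℂ) • c t := by
    apply Lp.ext
    filter_upwards [hk t ht.le, h.cubic_ae t ht.le, Lp.coeFn_smul (4 : ℂ) (c t)] with x h1 h2 h3
    rw [h1, h3, Pi.smul_apply, h2, smul_eq_mul]
    push_cast
    ring
  have hkc : ContinuousAt k t := by
    -- `R` bounds |v|² for all times near `t`. The pointwise Lipschitz constant 6R is 2R from the
    -- factor (|a|² + |b|²) plus 4R from the change in |a|².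
    set R : ℝ := 2 * (‖u t‖ ^ 2 + ‖ux t‖ ^ 2) + 1 with hR
    have ev : ∀ᶠ s in 𝓝 t, 2 * (‖u s‖ ^ 2 + ‖ux s‖ ^ 2) < R := by
      have : ContinuousAt (fun s => 2 * (‖u s‖ ^ 2 + ‖ux s‖ ^ 2)) t :=
        (((h.continuousAt_u ht).norm.pow 2).add ((h.continuousAt_ux ht).norm.pow 2)).const_mul 2
      exact this.eventually_lt continuousAt_const (by simp [hR])
    have l1 : Tendsto (fun s => 6 * R * ‖u s - u t‖) (𝓝 t) (𝓝 0) := by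
      have := (((h.continuousAt_u ht).sub (continuousAt_const (y := u t))).norm.const_mul
        (6 * R)).tendsto
      simpa using this
    refine tendsto_iff_norm_sub_tendsto_zero.2 (squeeze_zero' (.of_forall fun s => norm_nonneg _)
      ?_ l1)
    filter_upwards [eventually_nonneg ht, ev] with s hs hsR
    refine Lp.norm_le_mul_norm_of_ae_le_mul ?_
    filter_upwards [hk s hs, hk t ht.le, Lp.coeFn_sub (k s) (k t), h.sub_ae hs ht.le,
      ae_restrict_mem measurableSet_Ioi] with x h1 h2 h3 h4 hx
    rw [h3, Pi.sub_apply, h1, h2, h4]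
    have ha : ‖v s x‖ ^ 2 ≤ R := (h.norm_v_sq_le hs (le_of_lt hx)).trans hsR.le
    have hb : ‖v t x‖ ^ 2 ≤ R := (h.norm_v_sq_le ht.le (le_of_lt hx)).trans (by simp [hR])
    generalize v s x = a at *
    generalize v t x = b at *
    have e : ((‖a‖ ^ 2 + ‖b‖ ^ 2 : ℝ) : ℂ) * (a + b) - ((‖b‖ ^ 2 + ‖b‖ ^ 2 : ℝ) : ℂ) * (b + b)
        = ((‖a‖ ^ 2 + ‖b‖ ^ 2 : ℝ) : ℂ) * (a - b)
          + ((2 * ((‖a‖ - ‖b‖) * (‖a‖ + ‖b‖)) : ℝ) : ℂ) * b := by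
      push_cast; ring
    rw [e]
    refine (norm_add_le _ _).trans ?_
    rw [norm_mul, norm_mul, Complex.norm_real, Complex.norm_real,
      Real.norm_of_nonneg (by positivity), Real.norm_eq_abs, abs_mul, abs_mul, abs_two,
      abs_of_nonneg (show 0 ≤ ‖a‖ + ‖b‖ by positivity)]
    have hd := abs_norm_sub_norm_le a b
    have h5 : |‖a‖ - ‖b‖| * ((‖a‖ + ‖b‖) * ‖b‖) ≤ ‖a - b‖ * (2 * R) :=
      mul_le_mul hd (by nlinarith [sq_nonneg (‖a‖ - ‖b‖)]) (by positivity) (norm_nonneg _)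
    nlinarith [norm_nonneg (a - b)]
  have key := hasDerivAt_of_inner_increment (L := Complex.reCLM) (h.hasDerivAt t ht)
    (F := fun s => (inner ℂ (u s) (c s)).re) hkc
    (hasDerivAt_const t (0 : ℂ)) (continuousAt_const (y := (0 : ℂ))) (by
      filter_upwards [eventually_nonneg ht] with s hs
      have mem : ∀ {f : L2} {F : ℝ → ℂ}, f =ᵐ[halfLine] F → MemLp F 2 halfLine := fun hf =>
        (memLp_congr_ae hf).1 (Lp.memLp _)
      have i1 := (mem (h.u_ae s hs)).integrable_conj_mul (mem (h.cubic_ae s hs))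
      have i2 := (mem (h.u_ae t ht.le)).integrable_conj_mul (mem (h.cubic_ae t ht.le))
      have i3 := (mem (h.sub_ae hs ht.le)).integrable_conj_mul (mem (hk s hs))
      have re_int : ∀ {f : ℝ → ℂ}, Integrable f halfLine →
          (∫ x in Ioi 0, f x).re = ∫ x in Ioi 0, (f x).re := fun hf =>
        (Complex.reCLM.integral_comp_comm hf).symm
      simp only [sub_self, map_zero, zero_mul, add_zero, Complex.reCLM_apply]
      rw [inner_eq_integral (h.u_ae s hs) (h.cubic_ae s hs),
        inner_eq_integral (h.u_ae t ht.le) (h.cubic_ae t ht.le),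
        inner_eq_integral (h.sub_ae hs ht.le) (hk s hs), re_int i1, re_int i2, re_int i3,
        ← integral_sub (f := fun x => (_ : ℂ).re) (g := fun x => (_ : ℂ).re) i1.re i2.re]
      congr 1
      ext x
      have n : ∀ z : ℂ, ‖z‖ ^ 2 = z.re * z.re + z.im * z.im := fun z => by
        rw [← Complex.normSq_eq_norm_sq, Complex.normSq_apply]
      simp only [n, Complex.mul_re, Complex.mul_im, Complex.conj_re,
        Complex.conj_im, Complex.ofReal_re, Complex.ofReal_im, Complex.sub_re, Complex.sub_im,
        Complex.add_re, Complex.add_im]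
      ring)
  convert key using 1
  rw [hkt, inner_smul_right]
  simp

/-- Evolution of the energy. -/
theorem hasDerivAt_energy (h : IsStrongSolution v p u ux uxx c du) {t : ℝ} (ht : 0 < t) {b' : ℂ}
    (hb : HasDerivAt (fun s => v s 0) b' t) :
    HasDerivAt (fun s => ‖ux s‖ ^ 2 + (inner ℂ (u s) (c s)).re)
      (- 2 * (conj b' * p t 0).re) t := by
  refine ((h.hasDerivAt_kinetic ht hb).add (h.hasDerivAt_potential ht)).congr_deriv ?_
  -- The equation reads `du = i g` with `g = uxx − 2c`, and Re⟨i g, g⟩ = 0: only the boundary can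
  -- change the energy.
  have e1 : (inner ℂ (du t) (uxx t - (2 : ℂ) • c t)).re = 0 := by
    have e2 : inner ℂ (uxx t - (2 : ℂ) • c t) (uxx t - (2 : ℂ) • c t)
        = ((‖uxx t - (2 : ℂ) • c t‖ ^ 2 : ℝ) : ℂ) := by
      rw [inner_self_eq_norm_sq_to_K]; push_cast; rfl
    rw [h.equation t ht, inner_smul_left, e2, Complex.conj_I, Complex.mul_re, Complex.ofReal_im]
    simp
  rw [inner_sub_right, inner_smul_right] at e1
  simp only [Complex.sub_re, Complex.mul_re, Complex.re_ofNat, Complex.im_ofNat] at e1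
  linarith

end IsStrongSolution

/-! ### Exponential truncation of the weight x -/

theorem IsWeight.norm_mulCLM_le_of_ae {w : ℝ → ℝ} (hw : IsWeight w) {f : L2} {g : ℝ → ℂ}
    (hg : MemLp g 2 halfLine) (h : ∀ᵐ x ∂halfLine, ‖(w x : ℂ) * f x‖ ≤ ‖g x‖) :
    ‖hw.mulCLM f‖ ≤ ‖hg.toLp g‖ := by
  refine Lp.norm_le_norm_of_ae_le ?_
  filter_upwards [h, hw.coeFn_mulCLM f, hg.coeFn_toLp] with x h1 h2 h3
  rwa [h2, h3]

theorem IsWeight.norm_mulCLM_le {w : ℝ → ℝ} (hw : IsWeight w) {C : ℝ}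
    (hC : ∀ x ∈ Ioi (0 : ℝ), |w x| ≤ C) (f : L2) : ‖hw.mulCLM f‖ ≤ C * ‖f‖ := by
  refine Lp.norm_le_mul_norm_of_ae_le_mul ?_
  filter_upwards [hw.coeFn_mulCLM f, ae_restrict_mem measurableSet_Ioi] with x h1 hx
  rw [h1, norm_mul, Complex.norm_real, Real.norm_eq_abs]
  exact mul_le_mul_of_nonneg_right (hC x hx) (norm_nonneg _)

theorem isWeight_exp {ε : ℝ} (hε : 0 < ε) : IsWeight fun x => Real.exp (-(ε * x)) :=
  ⟨by fun_prop, 1, fun x hx => by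
    rw [abs_of_pos (Real.exp_pos _)]
    exact Real.exp_le_one_iff.2 (neg_nonpos.2 (mul_pos hε hx).le)⟩

theorem isWeight_truncation {ε : ℝ} (hε : 0 < ε) :
    IsWeight fun x => (1 - Real.exp (-(ε * x))) * ε⁻¹ :=
  ((IsWeight.const 1).sub (isWeight_exp hε)).mul (.const ε⁻¹)

theorem hasDerivAt_exp_neg_mul (ε x : ℝ) :
    HasDerivAt (fun x => Real.exp (-(ε * x))) (-ε * Real.exp (-(ε * x))) x := by
  have := (((hasDerivAt_id x).const_mul ε).neg).exp
  simpa [mul_comm] using this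

theorem isC1Weight_exp {ε : ℝ} (hε : 0 < ε) :
    IsC1Weight (fun x => Real.exp (-(ε * x))) (fun x => -ε * Real.exp (-(ε * x))) :=
  ⟨hasDerivAt_exp_neg_mul ε, isWeight_exp hε, (IsWeight.const (-ε)).mul (isWeight_exp hε)⟩

/-- The bounded weight `(1 - exp (-ε x)) / ε` approximates the weight `x`. -/
theorem isC1Weight_truncation {ε : ℝ} (hε : 0 < ε) :
    IsC1Weight (fun x => (1 - Real.exp (-(ε * x))) * ε⁻¹) (fun x => Real.exp (-(ε * x))) := by
  refine ⟨fun x => ?_, isWeight_truncation hε, isWeight_exp hε⟩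
  refine (((hasDerivAt_exp_neg_mul ε x).const_sub 1).mul_const ε⁻¹).congr_deriv ?_
  field_simp

theorem IsC1Weight.sq {w w' : ℝ → ℝ} (hw : IsC1Weight w w') :
    IsC1Weight (fun x => w x * w x) (fun x => 2 * (w x * w' x)) :=
  ⟨fun x => ((hw.hasDerivAt x).mul (hw.hasDerivAt x)).congr_deriv (by ring),
    hw.weight.mul hw.weight, (IsWeight.const 2).mul (hw.weight.mul hw.weight_deriv)⟩

theorem isWeight_tail {ε : ℝ} (hε : 0 < ε) : IsWeight fun x => 1 - Real.exp (-(ε * x)) :=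
  (IsWeight.const 1).sub (isWeight_exp hε)

theorem tail_mem {ε x : ℝ} (hε : 0 < ε) (hx : x ∈ Ioi (0 : ℝ)) :
    0 ≤ 1 - Real.exp (-(ε * x)) ∧ 1 - Real.exp (-(ε * x)) ≤ 1 := by
  have h1 : Real.exp (-(ε * x)) ≤ 1 := Real.exp_le_one_iff.2 (neg_nonpos.2 (mul_pos hε hx).le)
  exact ⟨by linarith, by linarith [Real.exp_pos (-(ε * x))]⟩

theorem norm_tail_le {ε : ℝ} (hε : 0 < ε) (f : L2) : ‖(isWeight_tail hε).mulCLM f‖ ≤ ‖f‖ := by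
  refine ((isWeight_tail hε).norm_mulCLM_le (C := 1) (fun x hx => ?_) f).trans_eq (one_mul _)
  rw [abs_of_nonneg (tail_mem hε hx).1]
  exact (tail_mem hε hx).2

theorem norm_exp_mulCLM_le {ε : ℝ} (hε : 0 < ε) (f : L2) :
    ‖(isWeight_exp hε).mulCLM f‖ ≤ ‖f‖ := by
  refine ((isWeight_exp hε).norm_mulCLM_le (C := 1) (fun x hx => ?_) f).trans_eq (one_mul _)
  rw [abs_of_pos (Real.exp_pos _)]
  exact Real.exp_le_one_iff.2 (neg_nonpos.2 (mul_pos hε hx).le)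

/-- Dominated convergence: the multiplier lies in [0, 1] on the half-line and tends to 0 at each
point. -/
theorem tendsto_norm_tail {ε : ℕ → ℝ} (hε : ∀ n, 0 < ε n) (h0 : Tendsto ε atTop (𝓝 0)) (f : L2) :
    Tendsto (fun n => ‖(isWeight_tail (hε n)).mulCLM f‖) atTop (𝓝 0) := by
  have key : Tendsto (fun n => ‖(isWeight_tail (hε n)).mulCLM f‖ ^ 2) atTop (𝓝 0) := by
    simp only [fun n => norm_sq_eq_integral ((isWeight_tail (hε n)).coeFn_mulCLM f)]
    have e : (0 : ℝ) = ∫ _ in Ioi (0 : ℝ), (0 : ℝ) := by simp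
    nth_rw 2 [e]
    refine tendsto_integral_of_dominated_convergence
      (F := fun n x => ‖((1 - Real.exp (-(ε n * x)) : ℝ) : ℂ) * f x‖ ^ 2) (fun x => ‖f x‖ ^ 2)
      (fun n => (((isWeight_tail (hε n)).memLp_mul (Lp.memLp f)).1.norm.pow 2))
      (integrable_norm_sq (ae_eq_refl _)) (fun n => ?_) (.of_forall fun x => ?_)
    · filter_upwards [ae_restrict_mem measurableSet_Ioi] with x hx
      rw [norm_mul, Complex.norm_real, Real.norm_of_nonneg (by positivity)]
      refine pow_le_pow_left₀ (by positivity) (mul_le_of_le_one_left (norm_nonneg _) ?_) 2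
      rw [Real.norm_of_nonneg (tail_mem (hε n) hx).1]
      exact (tail_mem (hε n) hx).2
    · have h1 : Tendsto (fun n => 1 - Real.exp (-(ε n * x))) atTop (𝓝 0) := by
        have := ((Real.continuous_exp.tendsto _).comp (h0.mul_const x).neg).const_sub 1
        simpa using this
      have h2 : Tendsto (fun n => (((1 - Real.exp (-(ε n * x)) : ℝ) : ℂ)) * f x) atTop (𝓝 0) := by
        have := ((Complex.continuous_ofReal.tendsto _).comp h1).mul_const (f x)
        simpa using this
      simpa using h2.norm.pow 2
  have := (Real.continuous_sqrt.tendsto _).comp key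
  simpa only [Function.comp_def, Real.sqrt_sq (norm_nonneg _), Real.sqrt_zero] using this

/-- The truncated weight is dominated by `x`. -/
theorem norm_truncation_le {ε : ℝ} (hε : 0 < ε) {f : L2} {F : ℝ → ℂ} (hf : f =ᵐ[halfLine] F)
    (hF : MemLp (fun x : ℝ => (x : ℂ) * F x) 2 halfLine) :
    ‖(isC1Weight_truncation hε).weight.mulCLM f‖ ≤ ‖hF.toLp _‖ := by
  refine (isC1Weight_truncation hε).weight.norm_mulCLM_le_of_ae hF ?_
  filter_upwards [hf, ae_restrict_mem measurableSet_Ioi] with x h1 hx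
  have hx0 : (0 : ℝ) < x := hx
  rw [h1, norm_mul, norm_mul, Complex.norm_real, Complex.norm_real, Real.norm_of_nonneg hx0.le,
    Real.norm_of_nonneg (mul_nonneg (tail_mem hε hx).1 (inv_nonneg.2 hε.le))]
  refine mul_le_mul_of_nonneg_right ?_ (norm_nonneg _)
  rw [← div_eq_mul_inv, div_le_iff₀ hε]
  linarith [Real.add_one_le_exp (-(ε * x))]

/-! ### The quartic integral and the truncated second moment -/

namespace IsStrongSolution

variable {v p : ℝ → ℝ → ℂ} {u ux uxx c du : ℝ → L2}

/-- One factor of the quartic tail carries the vanishing multiplier, while the H¹ sup bound controls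
|v|² in the cubic factor. -/
theorem re_inner_cubic_tail_le (h : IsStrongSolution v p u ux uxx c du) {t : ℝ} (ht : 0 ≤ t)
    {ε : ℝ} (hε : 0 < ε) :
    (inner ℂ (c t) ((isWeight_tail hε).mulCLM (u t))).re
      ≤ 2 * (‖u t‖ ^ 2 + ‖ux t‖ ^ 2) * (‖u t‖ * ‖(isWeight_tail hε).mulCLM (u t)‖) := by
  have hc : ‖c t‖ ≤ 2 * (‖u t‖ ^ 2 + ‖ux t‖ ^ 2) * ‖u t‖ := by
    refine Lp.norm_le_mul_norm_of_ae_le_mul ?_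
    filter_upwards [h.cubic_ae t ht, h.u_ae t ht, ae_restrict_mem measurableSet_Ioi] with x h1 h2 hx
    rw [h1, h2, norm_mul, Complex.norm_real, Real.norm_of_nonneg (by positivity)]
    exact mul_le_mul_of_nonneg_right (h.norm_v_sq_le ht (le_of_lt hx)) (norm_nonneg _)
  refine (Complex.re_le_norm _).trans ((norm_inner_le_norm _ _).trans ?_)
  rw [← mul_assoc]
  exact mul_le_mul_of_nonneg_right hc (norm_nonneg _)

theorem re_inner_u_c (h : IsStrongSolution v p u ux uxx c du) {t : ℝ} (ht : 0 ≤ t) :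
    (inner ℂ (u t) (c t)).re = ∫ x in Ioi 0, ‖v t x‖ ^ 4 := by
  have := h.inner_cubic ht (IsWeight.const 1)
  rw [IsWeight.mulCLM_one] at this
  rw [← inner_conj_symm, this, Complex.conj_re, Complex.ofReal_re]
  simp only [one_mul]

theorem integrableOn_norm_pow_four (h : IsStrongSolution v p u ux uxx c du) {t : ℝ} (ht : 0 ≤ t) :
    IntegrableOn (fun x => ‖v t x‖ ^ 4) (Ioi 0) := by
  have hm := ((h.primitive_u t ht).continuousOn.mono Ioi_subset_Ici_self).aestronglyMeasurable
    (μ := volume) measurableSet_Ioi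
  refine ((integrable_norm_sq (h.u_ae t ht)).const_mul (2 * (‖u t‖ ^ 2 + ‖ux t‖ ^ 2))).mono'
    (hm.norm.pow 4) ?_
  filter_upwards [ae_restrict_mem measurableSet_Ioi] with x hx
  rw [Real.norm_of_nonneg (by positivity), show ‖v t x‖ ^ 4 = ‖v t x‖ ^ 2 * ‖v t x‖ ^ 2 by ring]
  exact mul_le_mul_of_nonneg_right (h.norm_v_sq_le ht (le_of_lt hx)) (by positivity)

/-- Evolution of the truncated second moment. -/
theorem hasDerivAt_truncation (h : IsStrongSolution v p u ux uxx c du) {ε : ℝ} (hε : 0 < ε)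
    {t : ℝ} (ht : 0 < t) :
    HasDerivAt (fun s => ‖(isC1Weight_truncation hε).weight.mulCLM (u s)‖ ^ 2)
      (4 * (inner ℂ ((isC1Weight_truncation hε).weight.mulCLM (u t))
        ((isWeight_exp hε).mulCLM (ux t))).im) t := by
  set hw := isC1Weight_truncation hε
  have Zeq : (fun s => ‖hw.weight.mulCLM (u s)‖ ^ 2)
      = fun s => (inner ℂ (u s) (hw.sq.weight.mulCLM (u s))).re := funext fun s => by
    have e : inner ℂ (u s) (hw.sq.weight.mulCLM (u s))
        = ((‖hw.weight.mulCLM (u s)‖ ^ 2 : ℝ) : ℂ) := by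
      rw [← hw.weight.mulCLM_mulCLM hw.weight hw.sq.weight (fun _ => rfl), ← hw.weight.mulCLM_inner,
        inner_self_eq_norm_sq_to_K]
      push_cast; rfl
    rw [e, Complex.ofReal_re]
  rw [Zeq]
  refine (h.hasDerivAt_mass hw.sq ht).congr_deriv ?_
  have e : hw.sq.weight_deriv.mulCLM (ux t) = (2 : ℂ) • hw.weight.mulCLM
      ((isWeight_exp hε).mulCLM (ux t)) := by
    rw [hw.weight.mulCLM_mulCLM (isWeight_exp hε) (hw.weight.mul (isWeight_exp hε)) (fun _ => rfl)]
    apply Lp.ext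
    filter_upwards [hw.sq.weight_deriv.coeFn_mulCLM (ux t),
      (hw.weight.mul (isWeight_exp hε)).coeFn_mulCLM (ux t), Lp.coeFn_smul (2 : ℂ)
        ((hw.weight.mul (isWeight_exp hε)).mulCLM (ux t))] with x h1 h2 h3
    rw [h1, h3, Pi.smul_apply, h2, smul_eq_mul]
    push_cast; ring
  rw [e, inner_smul_right, ← hw.weight.mulCLM_inner]
  simp
  ring

/-- The truncated second moment at time one is bounded uniformly in the truncation. -/
theorem exists_norm_truncation_le (h : IsStrongSolution v p u ux uxx c du)
    (hx : MemLp (fun x : ℝ => (x : ℂ) * v 0 x) 2 halfLine) :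
    ∃ M : ℝ, ∀ ε (hε : 0 < ε), ‖(isC1Weight_truncation hε).weight.mulCLM (u 1)‖ ^ 2 ≤ M := by
  obtain ⟨κ, hκ⟩ := (isCompact_Icc (a := (0 : ℝ)) (b := 1)).exists_bound_of_continuousOn
    ((h.continuousOn_ux.mono Icc_subset_Ici_self).norm.pow 2)
  have hκ' : ∀ t ∈ Icc (0 : ℝ) 1, ‖ux t‖ ^ 2 ≤ κ := fun t ht =>
    (le_abs_self _).trans (hκ t ht)
  have hκ0 : 0 ≤ κ := (sq_nonneg _).trans (hκ' 0 (by simp))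
  refine ⟨(‖hx.toLp _‖ ^ 2 + 2 * κ) * Real.exp 2, fun ε hε => ?_⟩
  set hw := isC1Weight_truncation hε with hw_def
  set Z : ℝ → ℝ := fun s => ‖hw.weight.mulCLM (u s)‖ ^ 2 with hZ
  have Zcont : ContinuousOn Z (Icc 0 1) :=
    (hw.weight.mulCLM.continuous.comp_continuousOn
      (h.continuousOn_u.mono Icc_subset_Ici_self)).norm.pow 2
  -- A Grönwall argument: 4‖A‖‖ux‖ ≤ 2‖A‖² + 2‖ux‖² gives Z' ≤ 2Z + 2κ with constants independent of
  -- ε, where `A` is the truncated weight times `u`.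
  have anti : AntitoneOn (fun t => Z t * Real.exp (-(2 * t)) - 2 * κ * t) (Icc 0 1) := by
    refine antitoneOn_of_hasDerivWithinAt_nonpos (convex_Icc _ _)
      ((Zcont.mul (by fun_prop)).sub (by fun_prop))
      (f' := fun t => 4 * (inner ℂ (hw.weight.mulCLM (u t))
        ((isWeight_exp hε).mulCLM (ux t))).im * Real.exp (-(2 * t))
        + Z t * (-2 * Real.exp (-(2 * t))) - 2 * κ * 1) ?_ ?_
    · intro t ht
      rw [interior_Icc] at ht
      exact (((h.hasDerivAt_truncation hε ht.1).mul (hasDerivAt_exp_neg_mul 2 t)).sub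
        ((hasDerivAt_id t).const_mul (2 * κ))).hasDerivWithinAt
    · intro t ht
      rw [interior_Icc] at ht
      have b1 := (le_abs_self _).trans ((Complex.abs_im_le_norm _).trans
        (norm_inner_le_norm (𝕜 := ℂ) (hw.weight.mulCLM (u t)) ((isWeight_exp hε).mulCLM (ux t))))
      have b2 := norm_exp_mulCLM_le hε (ux t)
      have b3 := hκ' t ⟨ht.1.le, ht.2.le⟩
      have b4 : 4 * (inner ℂ (hw.weight.mulCLM (u t)) ((isWeight_exp hε).mulCLM (ux t))).im - 2 * Z t
          ≤ 2 * κ := by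
        rw [hZ]
        nlinarith [sq_nonneg (‖hw.weight.mulCLM (u t)‖ - ‖ux t‖),
          mul_le_mul_of_nonneg_left b2 (norm_nonneg (hw.weight.mulCLM (u t)))]
      have b5 : Real.exp (-(2 * t)) ≤ 1 := Real.exp_le_one_iff.2 (by linarith [ht.1])
      nlinarith [mul_le_mul_of_nonneg_right b4 (Real.exp_pos (-(2 * t))).le,
        mul_le_mul_of_nonneg_left b5 hκ0]
  have h01 := anti (left_mem_Icc.2 zero_le_one) (right_mem_Icc.2 zero_le_one) zero_le_one
  have hz0 : Z 0 ≤ ‖hx.toLp _‖ ^ 2 := by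
    exact pow_le_pow_left₀ (norm_nonneg _) (norm_truncation_le hε (h.u_ae 0 le_rfl) hx) 2
  show Z 1 ≤ _
  simp only [mul_zero, neg_zero, Real.exp_zero, mul_one, sub_zero] at h01
  have h02 : Z 1 * Real.exp (-2) ≤ ‖hx.toLp _‖ ^ 2 + 2 * κ := by linarith
  calc Z 1 = Z 1 * Real.exp (-2) * Real.exp 2 := by
        rw [mul_assoc, ← Real.exp_add]; simp
    _ ≤ _ := mul_le_mul_of_nonneg_right h02 (Real.exp_pos _).le

end IsStrongSolution

/-! ### The Lyapunov functional -/

/-- Completing the square in the boundary contribution. -/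
theorem boundary_term_le {P Q b : ℂ} {t C : ℝ} (ht : 1 ≤ t) (hQ : ‖Q‖ ≤ C / t)
    (hb : ‖b‖ ≤ C / t ^ 2) :
    -4 * (conj P * Q).re - 2 * (4 * t + 1) * (conj b * P).re + 2 * (conj Q * P).im
      - (‖P‖ ^ 2 - ‖Q‖ ^ 4 - (conj Q * b).im) ≤ (65 * C ^ 2 + C ^ 4) / t ^ 2 := by
  have t0 : 0 < t := by linarith
  have hC : 0 ≤ C := by
    have := (norm_nonneg Q).trans hQ
    by_contra h
    exact absurd this (not_le.2 (div_neg_of_neg_of_pos (not_le.1 h) t0))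
  set r := C / t with hr
  have r0 : 0 ≤ r := by positivity
  have hbt : t * ‖b‖ ≤ r := by
    calc t * ‖b‖ ≤ t * (C / t ^ 2) := mul_le_mul_of_nonneg_left hb t0.le
      _ = r := by rw [hr]; field_simp
  have hb1 : ‖b‖ ≤ r := (le_mul_of_one_le_left (norm_nonneg b) ht).trans hbt
  have re : ∀ z w : ℂ, |(conj z * w).re| ≤ ‖z‖ * ‖w‖ := fun z w => by
    refine (Complex.abs_re_le_norm _).trans_eq ?_
    rw [norm_mul, RCLike.norm_conj]
  have im : ∀ z w : ℂ, |(conj z * w).im| ≤ ‖z‖ * ‖w‖ := fun z w => by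
    refine (Complex.abs_im_le_norm _).trans_eq ?_
    rw [norm_mul, RCLike.norm_conj]
  have e1 := (abs_le.1 (re P Q)).1
  have e2 := (abs_le.1 (re b P)).1
  have e3 := (abs_le.1 (im Q P)).2
  have e4 := (abs_le.1 (im Q b)).2
  have rC : r ≤ C := div_le_self hC ht
  have q2 : ‖Q‖ * ‖b‖ ≤ r * r := mul_le_mul hQ hb1 (norm_nonneg _) r0
  have q4 : ‖Q‖ ^ 4 ≤ r ^ 4 := pow_le_pow_left₀ (norm_nonneg _) hQ 4
  have q4' : r ^ 4 ≤ C ^ 2 * r ^ 2 := by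
    nlinarith [pow_le_pow_left₀ r0 rC 2, sq_nonneg r]
  have pq : ‖P‖ * ‖Q‖ ≤ ‖P‖ * r := mul_le_mul_of_nonneg_left hQ (norm_nonneg _)
  -- The 5 is 4 + 1: both t‖b‖ and ‖b‖ are at most `r`.
  have pb : (4 * t + 1) * (‖b‖ * ‖P‖) ≤ 5 * r * ‖P‖ := by
    rw [← mul_assoc]
    exact mul_le_mul_of_nonneg_right (by linarith) (norm_nonneg _)
  have pb' : -(2 * (4 * t + 1) * (conj b * P).re) ≤ 10 * r * ‖P‖ := by
    have := mul_le_mul_of_nonneg_left e2 (show 0 ≤ 4 * t + 1 by linarith)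
    linarith
  have fin : (65 * C ^ 2 + C ^ 4) / t ^ 2 = 65 * r ^ 2 + C ^ 2 * r ^ 2 := by
    rw [hr]; field_simp
  rw [fin]
  -- The linear terms total (4 + 10 + 2) r‖P‖ = 16 r‖P‖. Against −‖P‖² they cost 64 r², and the term
  -- in Q̄b adds one more r².
  nlinarith [sq_nonneg (‖P‖ - 8 * r)]

namespace IsStrongSolution

variable {v p : ℝ → ℝ → ℂ} {u ux uxx c du : ℝ → L2}

/-- The Lyapunov functional built from the truncated pseudoconformal energy, the energy, the mass
and the momentum. -/
noncomputable def lyapunov (u ux c : ℝ → L2) {ε : ℝ} (hε : 0 < ε) (t : ℝ) : ℝ :=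
  ‖(isC1Weight_truncation hε).weight.mulCLM (u t)‖ ^ 2 * t⁻¹
    - 4 * (inner ℂ (u t) ((isC1Weight_truncation hε).weight.mulCLM (ux t))).im
    + (4 * t + 1) * (‖ux t‖ ^ 2 + (inner ℂ (u t) (c t)).re)
    + (inner ℂ (u t) (IsC1Weight.one.weight.mulCLM (u t))).re
    - (inner ℂ (u t) (IsC1Weight.one.weight.mulCLM (ux t))).im

/-- The error caused by truncating the weight. -/
noncomputable def truncationError (u ux : ℝ → L2) {ε : ℝ} (hε : 0 < ε) (t : ℝ) : ℝ :=
  4 * ‖(isWeight_tail hε).mulCLM (ux t)‖ ^ 2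
    + 8 * (‖u t‖ ^ 2 + ‖ux t‖ ^ 2) * (‖u t‖ * ‖(isWeight_tail hε).mulCLM (u t)‖)
    + 4 * (ε * (‖ux t‖ * ‖u t‖))

theorem truncationError_continuousOn (h : IsStrongSolution v p u ux uxx c du) {ε : ℝ}
    (hε : 0 < ε) : ContinuousOn (truncationError u ux hε) (Ici 0) := by
  have h1 := h.continuousOn_u
  have h2 := h.continuousOn_ux
  have h3 := (isWeight_tail hε).mulCLM.continuous.comp_continuousOn h1
  have h4 := (isWeight_tail hε).mulCLM.continuous.comp_continuousOn h2
  exact (((h4.norm.pow 2).const_mul 4).add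
    ((((h1.norm.pow 2).add (h2.norm.pow 2)).const_mul 8).mul (h1.norm.mul h3.norm))).add
    (((h2.norm.mul h1.norm).const_mul ε).const_mul 4)

/-- Dominated convergence in time on the compact interval [1, T]; dropping the multipliers and using
ε ≤ 1 gives the continuous majorant. -/
theorem tendsto_integral_truncationError (h : IsStrongSolution v p u ux uxx c du) {ε : ℕ → ℝ}
    (hε : ∀ n, 0 < ε n) (hε1 : ∀ n, ε n ≤ 1) (h0 : Tendsto ε atTop (𝓝 0)) {T : ℝ} (hT : 1 ≤ T) :
    Tendsto (fun n => ∫ t in 1..T, truncationError u ux (hε n) t) atTop (𝓝 0) := by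
  have sub : uIcc 1 T ⊆ Ici (0 : ℝ) := by
    rw [uIcc_of_le hT]
    exact fun t ht => zero_le_one.trans ht.1
  have h1 := h.continuousOn_u.mono sub
  have h2 := h.continuousOn_ux.mono sub
  have e : (0 : ℝ) = ∫ _ in (1 : ℝ)..T, (0 : ℝ) := by simp
  have key := intervalIntegral.tendsto_integral_filter_of_dominated_convergence (a := 1) (b := T)
    (μ := volume) (l := atTop) (F := fun n t => truncationError u ux (hε n) t) (f := fun _ => 0)
    (fun t => 4 * ‖ux t‖ ^ 2 + 8 * (‖u t‖ ^ 2 + ‖ux t‖ ^ 2) * (‖u t‖ * ‖u t‖)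
      + 4 * (1 * (‖ux t‖ * ‖u t‖)))
    (.of_forall fun n => (((h.truncationError_continuousOn (hε n)).mono
      (uIoc_subset_uIcc.trans sub)).aestronglyMeasurable measurableSet_uIoc))
    (.of_forall fun n => .of_forall fun t _ => ?_)
    (((((h2.norm.pow 2).const_mul 4).add
      ((((h1.norm.pow 2).add (h2.norm.pow 2)).const_mul 8).mul (h1.norm.mul h1.norm))).add
      (((h2.norm.mul h1.norm).const_mul 1).const_mul 4)).intervalIntegrable)
    (.of_forall fun t _ => ?_)
  · rwa [← e] at key
  · have e1 := hε n
    unfold truncationError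
    rw [Real.norm_of_nonneg (by positivity)]
    gcongr
    · exact norm_tail_le (hε n) _
    · exact norm_tail_le (hε n) _
    · exact hε1 n
  · have := ((((tendsto_norm_tail hε h0 (ux t)).pow 2).const_mul 4).add
      (((tendsto_norm_tail hε h0 (u t)).const_mul ‖u t‖).const_mul
        (8 * (‖u t‖ ^ 2 + ‖ux t‖ ^ 2)))).add ((h0.mul_const (‖ux t‖ * ‖u t‖)).const_mul 4)
    simpa [truncationError] using this

/-- The bulk splits into a nonpositive quadratic form in ‖A‖/t and ‖B‖ and the truncation defects.
As the truncated weight vanishes at 0 with slope 1, its momentum law contributes only −4 Re(P̄Q) at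
the boundary. -/
theorem exists_deriv_lyapunov_le (h : IsStrongSolution v p u ux uxx c du) {ε : ℝ} (hε : 0 < ε)
    {t C : ℝ} (ht : 1 ≤ t) {b' : ℂ} (hb : HasDerivAt (fun s => v s 0) b' t)
    (hQ : ‖v t 0‖ ≤ C / t) (hb' : ‖b'‖ ≤ C / t ^ 2) :
    ∃ w, HasDerivAt (lyapunov u ux c hε) w t ∧
      w ≤ truncationError u ux hε t + (65 * C ^ 2 + C ^ 4) / t ^ 2 := by
  have t0 : 0 < t := by linarith
  set hw := isC1Weight_truncation hε with hw_def
  have d1 := h.hasDerivAt_truncation hε t0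
  have d2 := h.hasDerivAt_momentum hw (isC1Weight_exp hε) t0 hb
  have d3 := h.hasDerivAt_energy t0 hb
  have d4 := h.hasDerivAt_mass IsC1Weight.one t0
  have d5 := h.hasDerivAt_momentum IsC1Weight.one
    (⟨fun x => hasDerivAt_const x 0, .const 0, .const 0⟩ : IsC1Weight (fun _ => 0) (fun _ => 0))
    t0 hb
  have d := ((((d1.mul (hasDerivAt_inv t0.ne')).sub (d2.const_mul 4)).add
    ((((hasDerivAt_id t).const_mul 4).add_const 1).mul d3)).add d4).sub d5
  refine ⟨_, d, ?_⟩
  have bd := boundary_term_le (P := p t 0) ht hQ hb'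
  simp only [IsWeight.mulCLM_zero, inner_zero_right, Complex.zero_im, Complex.zero_re, mul_zero,
    zero_mul, neg_zero, Real.exp_zero, sub_self, id_eq, mul_one, one_mul, zero_add, add_zero]
  set A := hw.weight.mulCLM (u t) with hA
  set B := (isWeight_exp hε).mulCLM (ux t) with hB
  have hD : (isWeight_tail hε).mulCLM (ux t) = ux t - B :=
    (isWeight_exp hε).mulCLM_one_sub (isWeight_tail hε) (fun _ => rfl) _
  have hD' : (isWeight_tail hε).mulCLM (u t) = u t - (isWeight_exp hε).mulCLM (u t) :=
    (isWeight_exp hε).mulCLM_one_sub (isWeight_tail hε) (fun _ => rfl) _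
  -- This rewrites 4‖ux‖² − 8 Re⟨ux, B⟩ as 4‖ux − B‖² − 4‖B‖²: a truncation error and the negative
  -- term needed in `k6`.
  have k1 : ‖(isWeight_tail hε).mulCLM (ux t)‖ ^ 2
      = ‖ux t‖ ^ 2 - 2 * (inner ℂ (ux t) B).re + ‖B‖ ^ 2 := by
    rw [hD]
    exact norm_sub_sq (𝕜 := ℂ) (ux t) B
  have k2 : (inner ℂ A B).im ≤ ‖A‖ * ‖B‖ :=
    (le_abs_self _).trans ((Complex.abs_im_le_norm _).trans (norm_inner_le_norm A B))
  have k3 : (inner ℂ (u t) (c t)).re - (inner ℂ (c t) ((isWeight_exp hε).mulCLM (u t))).re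
      = (inner ℂ (c t) ((isWeight_tail hε).mulCLM (u t))).re := by
    rw [hD', inner_sub_right, Complex.sub_re, ← inner_conj_symm (u t), Complex.conj_re]
  have k4 := h.re_inner_cubic_tail_le t0.le hε
  have k5 : -(inner ℂ (ux t) ((isC1Weight_exp hε).weight_deriv.mulCLM (u t))).re
      ≤ ε * (‖ux t‖ * ‖u t‖) := by
    have n1 := (isC1Weight_exp hε).weight_deriv.norm_mulCLM_le (C := ε) (fun x hx => by
      rw [abs_mul, abs_neg, abs_of_pos hε, abs_of_pos (Real.exp_pos _)]
      exact mul_le_of_le_one_right hε.le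
        (Real.exp_le_one_iff.2 (neg_nonpos.2 (mul_pos hε hx).le))) (u t)
    refine (neg_le_abs _).trans ((Complex.abs_re_le_norm _).trans
      ((norm_inner_le_norm _ _).trans ?_))
    calc _ ≤ ‖ux t‖ * (ε * ‖u t‖) := mul_le_mul_of_nonneg_left n1 (norm_nonneg _)
      _ = _ := by ring
  -- The left side is at most −(‖A‖/t − 2‖B‖)².
  have k6 : 4 * (inner ℂ A B).im * t⁻¹ + ‖A‖ ^ 2 * -(t ^ 2)⁻¹ - 4 * ‖B‖ ^ 2 ≤ 0 := by
    have i0 : 0 < t⁻¹ := inv_pos.2 t0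
    rw [← inv_pow]
    nlinarith [sq_nonneg (‖A‖ * t⁻¹ - 2 * ‖B‖), mul_le_mul_of_nonneg_right k2 i0.le]
  have k7 : (inner ℂ (c t) ((isWeight_exp hε).mulCLM (u t))).re
      = (inner ℂ (c t) ((isC1Weight_exp hε).weight.mulCLM (u t))).re := rfl
  have k8 : (inner ℂ (ux t) ((isC1Weight_exp hε).weight.mulCLM (ux t))).re
      = (inner ℂ (ux t) B).re := rfl
  unfold truncationError
  rw [k8, ← k7]
  linarith

/-- The pseudoconformal part is at least (‖A‖ − 2t‖ux‖)²/t + 4tN, and the momentum is absorbed by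
‖u‖² + ‖ux‖². -/
theorem lyapunov_ge (h : IsStrongSolution v p u ux uxx c du) {ε : ℝ} (hε : 0 < ε)
    {t : ℝ} (ht : 1 ≤ t) : 4 * t * (inner ℂ (u t) (c t)).re ≤ lyapunov u ux c hε t := by
  have t0 : 0 < t := by linarith
  have N0 : 0 ≤ (inner ℂ (u t) (c t)).re := by
    rw [h.re_inner_u_c t0.le]
    exact integral_nonneg fun x => by positivity
  unfold lyapunov
  simp only [IsWeight.mulCLM_one]
  rw [← IsWeight.mulCLM_inner]
  set A := (isC1Weight_truncation hε).weight.mulCLM (u t)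
  have k : ∀ a b : L2, (inner ℂ a b).im ≤ ‖a‖ * ‖b‖ := fun a b =>
    (le_abs_self _).trans ((Complex.abs_im_le_norm _).trans (norm_inner_le_norm a b))
  have k1 := k A (ux t)
  have k2 := k (u t) (ux t)
  have k3 : (inner ℂ (u t) (u t)).re = ‖u t‖ ^ 2 := inner_self_eq_norm_sq (𝕜 := ℂ) (u t)
  have k4 : 0 ≤ ‖A‖ ^ 2 * t⁻¹ - 4 * (‖A‖ * ‖ux t‖) + 4 * t * ‖ux t‖ ^ 2 := by
    have : ‖A‖ ^ 2 * t⁻¹ - 4 * (‖A‖ * ‖ux t‖) + 4 * t * ‖ux t‖ ^ 2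
        = (‖A‖ - 2 * t * ‖ux t‖) ^ 2 * t⁻¹ := by
      field_simp; ring
    rw [this]
    positivity
  rw [k3]
  nlinarith [sq_nonneg (‖u t‖ - ‖ux t‖)]

theorem lyapunov_one_le {ε : ℝ} (hε : 0 < ε) {M : ℝ}
    (hM : ‖(isC1Weight_truncation hε).weight.mulCLM (u 1)‖ ^ 2 ≤ M) :
    lyapunov u ux c hε 1 ≤ 3 * M + 2 * ‖ux 1‖ ^ 2
      + 5 * (‖ux 1‖ ^ 2 + (inner ℂ (u 1) (c 1)).re) + ‖u 1‖ ^ 2 + ‖u 1‖ * ‖ux 1‖ := by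
  unfold lyapunov
  simp only [IsWeight.mulCLM_one]
  rw [← IsWeight.mulCLM_inner]
  set A := (isC1Weight_truncation hε).weight.mulCLM (u 1)
  have k : ∀ a b : L2, -(inner ℂ a b).im ≤ ‖a‖ * ‖b‖ := fun a b =>
    (neg_le_abs _).trans ((Complex.abs_im_le_norm _).trans (norm_inner_le_norm a b))
  have k1 := k A (ux 1)
  have k2 := k (u 1) (ux 1)
  have k3 : (inner ℂ (u 1) (u 1)).re = ‖u 1‖ ^ 2 := inner_self_eq_norm_sq (𝕜 := ℂ) (u 1)
  rw [k3]
  norm_num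
  nlinarith [sq_nonneg (‖A‖ - ‖ux 1‖)]

/-- Growth bound for the Lyapunov functional. -/
theorem lyapunov_le (h : IsStrongSolution v p u ux uxx c du) {ε : ℝ} (hε : 0 < ε) {C : ℝ}
    {b' : ℝ → ℂ} (hb : ∀ t, 1 ≤ t → HasDerivAt (fun s => v s 0) (b' t) t)
    (hQ : ∀ t, 1 ≤ t → ‖v t 0‖ ≤ C / t) (hb' : ∀ t, 1 ≤ t → ‖b' t‖ ≤ C / t ^ 2)
    {T : ℝ} (hT : 1 ≤ T) :
    lyapunov u ux c hε T ≤ lyapunov u ux c hε 1 + (65 * C ^ 2 + C ^ 4)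
      + ∫ t in 1..T, truncationError u ux hε t := by
  set Γ := 65 * C ^ 2 + C ^ 4 with hΓ
  have Γ0 : 0 ≤ Γ := by positivity
  choose! w hw using fun t (ht : 1 ≤ t) =>
    h.exists_deriv_lyapunov_le hε ht (hb t ht) (hQ t ht) (hb' t ht)
  have hc := h.truncationError_continuousOn hε
  have hI : ∀ t, 1 ≤ t → HasDerivAt (fun t => ∫ s in 1..t, truncationError u ux hε s)
      (truncationError u ux hε t) t := fun t ht => by
    have t0 : 0 < t := by linarith
    have sub : uIcc 1 t ⊆ Ici (0 : ℝ) := by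
      rw [uIcc_of_le ht]
      exact fun s hs => zero_le_one.trans hs.1
    exact intervalIntegral.integral_hasDerivAt_right (hc.mono sub).intervalIntegrable
      (hc.stronglyMeasurableAtFilter_nhdsWithin measurableSet_Ici t |>.filter_mono
        (by rw [nhdsWithin_eq_nhds.2 (Ici_mem_nhds t0)]))
      (hc.continuousAt (Ici_mem_nhds t0))
  -- The correction Γ/t has derivative −Γ/t², which cancels the boundary bound; its value at t = 1
  -- is the constant Γ in the conclusion.
  have hd : ∀ t, 1 ≤ t → HasDerivAt (fun t => lyapunov u ux c hε t + Γ * t⁻¹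
      - ∫ s in 1..t, truncationError u ux hε s)
      (w t + Γ * -(t ^ 2)⁻¹ - truncationError u ux hε t) t := fun t ht =>
    ((hw t ht).1.add ((hasDerivAt_inv (by linarith)).const_mul Γ)).sub (hI t ht)
  have anti : AntitoneOn (fun t => lyapunov u ux c hε t + Γ * t⁻¹
      - ∫ s in 1..t, truncationError u ux hε s) (Ici 1) := by
    refine antitoneOn_of_hasDerivWithinAt_nonpos (convex_Ici _)
      (fun t ht => (hd t ht).continuousAt.continuousWithinAt)
      (fun t ht => (hd t (interior_subset ht)).hasDerivWithinAt) fun t ht => ?_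
    have := (hw t (interior_subset ht)).2
    rw [div_eq_mul_inv] at this
    linarith
  have := anti (mem_Ici.2 le_rfl) (mem_Ici.2 hT) hT
  simp only [inv_one, mul_one, intervalIntegral.integral_same, sub_zero] at this
  have hp : 0 ≤ Γ * T⁻¹ := mul_nonneg Γ0 (inv_nonneg.2 (by linarith))
  linarith

/-- Decay of the `L⁴` norm for strong solutions with decaying boundary values. -/
theorem exists_integral_norm_pow_four_le (h : IsStrongSolution v p u ux uxx c du)
    (hx : MemLp (fun x : ℝ => (x : ℂ) * v 0 x) 2 halfLine) {C : ℝ}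
    {b' : ℝ → ℂ} (hb : ∀ t, 1 ≤ t → HasDerivAt (fun s => v s 0) (b' t) t)
    (hQ : ∀ t, 1 ≤ t → ‖v t 0‖ ≤ C / t) (hb' : ∀ t, 1 ≤ t → ‖b' t‖ ≤ C / t ^ 2) :
    ∃ B : ℝ, ∀ t, 1 ≤ t → 4 * t * ∫ x in Ioi 0, ‖v t x‖ ^ 4 ≤ B := by
  obtain ⟨M, hM⟩ := h.exists_norm_truncation_le hx
  refine ⟨3 * M + 2 * ‖ux 1‖ ^ 2
      + 5 * (‖ux 1‖ ^ 2 + (inner ℂ (u 1) (c 1)).re) + ‖u 1‖ ^ 2 + ‖u 1‖ * ‖ux 1‖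
      + (65 * C ^ 2 + C ^ 4), fun t ht => ?_⟩
  have hε : ∀ n : ℕ, 0 < 1 / ((n : ℝ) + 1) := fun n => by positivity
  have lim := h.tendsto_integral_truncationError hε (fun n => by
    rw [div_le_one (by positivity)]
    have : (0 : ℝ) ≤ n := n.cast_nonneg
    linarith) tendsto_one_div_add_atTop_nhds_zero_nat ht
  have lim' := lim.const_add (3 * M + 2 * ‖ux 1‖ ^ 2
      + 5 * (‖ux 1‖ ^ 2 + (inner ℂ (u 1) (c 1)).re) + ‖u 1‖ ^ 2 + ‖u 1‖ * ‖ux 1‖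
      + (65 * C ^ 2 + C ^ 4))
  rw [add_zero] at lim'
  -- The left side does not depend on ε, so the limit removes the truncation error, and the constant
  -- left is independent of `t`.
  refine ge_of_tendsto' lim' fun n => ?_
  rw [← h.re_inner_u_c (by linarith)]
  have e1 := h.lyapunov_ge (hε n) ht
  have e2 := h.lyapunov_le (hε n) hb hQ hb' ht
  have e3 := lyapunov_one_le (u := u) (ux := ux) (c := c) (hε n) (hM _ (hε n))
  linarith

end IsStrongSolution

/-! ### Boundary decay and conclusion -/

/-- A continuous function that decays at infinity is bounded by a power on `[1, ∞)`. -/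
theorem exists_norm_le_div_pow {f : ℝ → ℂ} (hf : ContinuousOn f (Ici 1)) {γ : ℝ} (k : ℕ)
    (hk : (k : ℝ) ≤ γ) (hO : f =O[atTop] fun t : ℝ => t ^ (-γ)) :
    ∃ C : ℝ, ∀ t, 1 ≤ t → ‖f t‖ ≤ C / t ^ k := by
  obtain ⟨D, hD⟩ := hO.bound
  obtain ⟨t₀, ht₀⟩ := eventually_atTop.1 hD
  -- Before the asymptotic bound takes effect, compactness bounds `f t * t ^ k`.
  obtain ⟨M, hM⟩ := (isCompact_Icc (a := (1 : ℝ)) (b := max 1 t₀)).exists_bound_of_continuousOn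
    (f := fun t => f t * (t : ℂ) ^ k) ((hf.mono Icc_subset_Ici_self).mul (by fun_prop))
  refine ⟨max M |D|, fun t ht => ?_⟩
  have t0 : 0 < t := by linarith
  rw [le_div_iff₀ (by positivity)]
  rcases le_total t (max 1 t₀) with h1 | h1
  · have := hM t ⟨ht, h1⟩
    rw [norm_mul, norm_pow, Complex.norm_real, Real.norm_of_nonneg t0.le] at this
    exact this.trans (le_max_left _ _)
  · have h2 := ht₀ t ((le_max_right _ _).trans h1)
    rw [Real.norm_of_nonneg (Real.rpow_nonneg t0.le _)] at h2
    have h3 : t ^ (-γ) * t ^ k ≤ 1 := by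
      rw [← Real.rpow_natCast, ← Real.rpow_add t0]
      exact Real.rpow_le_one_of_one_le_of_nonpos ht (by linarith)
    have h4 : 0 ≤ t ^ (-γ) * t ^ k := by positivity
    calc ‖f t‖ * t ^ k ≤ D * t ^ (-γ) * t ^ k := mul_le_mul_of_nonneg_right h2 (by positivity)
      _ = D * (t ^ (-γ) * t ^ k) := by ring
      _ ≤ |D| * (t ^ (-γ) * t ^ k) := mul_le_mul_of_nonneg_right (le_abs_self D) h4
      _ ≤ |D| := mul_le_of_le_one_right (abs_nonneg D) h3
      _ ≤ _ := le_max_right _ _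

end HalfLineNLS

theorem theorem2 (q₀ Q : ℝ → ℂ) (q : ℝ → ℝ → ℂ)
    (hQ : ContDiffOn ℝ 2 Q (Ici 0))
    (hcomp : Q 0 = q₀ 0)
    (hq : HalfLineNLS.IsSolution q₀ Q q)
    (hxq₀ : MemLp (fun x : ℝ => (x : ℂ) * q₀ x) 2 (volume.restrict (Ioi 0)))
    (α β : ℝ) (hα : 3 / 2 < α) (hβ : 5 / 2 < β)
    (hdecay : (fun t : ℝ => q 0 t) =O[atTop] fun t : ℝ => t ^ (-α))
    (hdecay_t : (fun t : ℝ => deriv (fun s : ℝ => q 0 s) t) =O[atTop] fun t : ℝ => t ^ (-β)) :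
    ∃ c : ℝ, 0 < c ∧ ∀ t : ℝ, 1 ≤ t →
      IntegrableOn (fun x : ℝ => ‖q x t‖ ^ 4) (Ioi 0) ∧
      ∫ x in Ioi 0, ‖q x t‖ ^ 4 ≤ c / t := by
  obtain ⟨p, u, ux, uxx, c, du, h⟩ := hq.exists_isStrongSolution
  have hd : ∀ t, 0 < t → HasDerivAt (fun s => q 0 s) (derivWithin Q (Ici 0) t) t := fun t ht => by
    refine HasDerivAt.congr_of_eventuallyEq
      (((hQ.differentiableOn (by simp) t ht.le).hasDerivWithinAt).hasDerivAt (Ici_mem_nhds ht)) ?_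
    filter_upwards [eventually_gt_nhds ht] with s hs
    exact hq.boundary s hs.le
  have hc1 : ContinuousOn (fun t => q 0 t) (Ici 1) := fun t ht =>
    (hd t (zero_lt_one.trans_le ht)).continuousAt.continuousWithinAt
  have hc2 : ContinuousOn (deriv fun s => q 0 s) (Ici 1) :=
    ((hQ.continuousOn_derivWithin (uniqueDiffOn_Ici 0) (by norm_num)).mono
      (Ici_subset_Ici.2 zero_le_one)).congr fun t ht => (hd t (zero_lt_one.trans_le ht)).deriv
  obtain ⟨C₁, h1⟩ := HalfLineNLS.exists_norm_le_div_pow hc1 1 (by norm_num; linarith) hdecay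
  obtain ⟨C₂, h2⟩ := HalfLineNLS.exists_norm_le_div_pow hc2 2 (by norm_num; linarith) hdecay_t
  have hx : MemLp (fun x : ℝ => (x : ℂ) * q x 0) 2 HalfLineNLS.halfLine := by
    refine (memLp_congr_ae ?_).1 hxq₀
    filter_upwards [ae_restrict_mem measurableSet_Ioi] with x hx
    rw [hq.initial x (le_of_lt hx)]
  obtain ⟨B, hB⟩ := h.exists_integral_norm_pow_four_le hx (C := max C₁ C₂)
    (b' := deriv fun s => q 0 s)
    (fun t ht => (hd t (by linarith)).differentiableAt.hasDerivAt)
    (fun t ht => (h1 t ht).trans (by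
      rw [pow_one]
      exact div_le_div_of_nonneg_right (le_max_left _ _) (by linarith)))
    (fun t ht => (h2 t ht).trans (div_le_div_of_nonneg_right (le_max_right _ _) (by positivity)))
  -- From 4tN ≤ B and N ≥ 0 one gets tN ≤ |B|; the added 1 makes the constant strictly positive.
  refine ⟨|B| + 1, by positivity, fun t ht => ⟨h.integrableOn_norm_pow_four (by linarith), ?_⟩⟩
  have t0 : 0 < t := by linarith
  have hI : 0 ≤ ∫ x in Ioi 0, ‖q x t‖ ^ 4 := integral_nonneg fun x => by positivity
  rw [le_div_iff₀ t0]
  have hBt := hB t ht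
  nlinarith [le_abs_self B, mul_nonneg hI t0.le]
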